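/- Let $d\ge 2$, let $\Omega\subset\mathbb R^d$ be a bounded convex open set and let $g:\partial\Omega\to[0,\infty)$ be bounded and lower semicontinuous. For $A\subset\mathbb R^d$ let $\mathcal M(A)$, $\mathcal M^+(A)$, $\mathcal M(A,\mathbb R^d)$ be the finite signed, finite nonnegative and finite $\mathbb R^d$-valued Borel measures on $\mathbb R^d$ carried by $A$; $|\sigma|$ is the total variation measure of $\sigma$, and $\nu=\nu^+-\nu^-$ is the Jordan decomposition. Let $\mathcal Lip_1(\Omega)$ be the set of Lipschitz functions $v$ on $\mathbb R^d$ with $v(y)-v(x)\le|x-y|$ for all $x,y\in\overline\Omega$. *Tangential gradient.* For a finite nonnegative Borel measure $\eta$ on $\mathbb R^d$ let $X_\eta$ be the set of $\psi\in L^2_\eta(\mathbb R^d)^d$ for which there is a constant $K$ with $\int D\varphi\cdot\psi\,d\eta\le K\|\varphi\|_\infty$ for all $\varphi\in C_c^\infty(\mathbb R^d)$. Let $T_\eta(x)$ be the $\eta$-essential union of $\{\psi(x):\psi\in X_\eta\}$ (the $\eta$-a.e. smallest closed-valued multifunction having every $\psi\in X_\eta$ as an $\eta$-a.e. selection; it is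 a linear subspace for $\eta$-a.e. $x$) and let $P_\eta(x)$ be the orthogonal projector onto $T_\eta(x)$. For $\varphi\in C_c^\infty(\mathbb R^d)$ put $D_\eta\varphi=P_\eta D\varphi$. For a function $v$ on $\mathbb R^d$ one writes $w=D_\eta v$ if $w\in L^2_\eta(\mathbb R^d)^d$ and there are $v_n\in C_c^\infty(\mathbb R^d)$ with $v_n\to v$ uniformly and $D_\eta v_n\rightharpoonup w$ weakly in $L^2_\eta(\mathbb R^d)^d$. If $\eta$ is carried by $\overline\Omega$ and $u$ is a Lipschitz function, $D_\eta u$ means $D_\eta v$ for a continuous compactly supported $v$ on $\mathbb R^d$ with $v=u$ on $\overline\Omega$. Let $\rho\in\mathcal M(\Omega)$ and consider $$\text{(max)}\qquad \max\Big\{\int v\,d\rho:\ v\in\mathcal Lip_1(\Omega),\ 0\le v\le g\text{ on }\partial\Omega\Big\},$$ $$\text{(mincurrent)}\qquad \inf\Big\{|\sigma|(\mathbb R^d)+\int_{\partial\Omega}g\,d\nu^+:\ \sigma\in\mathcal M(\Omega,\mathbb R^d),\ \nu\in\mathcal M(\partial\Omega),\ -\operatorname{div}\sigma=\rho-\nu\text{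 in }\mathbb R^d\Big\},$$ where $-\operatorname{div}\sigma=\rho-\nu$ in $\mathbb R^d$ means $\int D\varphi\cdot d\sigma=\int\varphi\,d(\rho-\nu)$ for all $\varphi\in C_c^\infty(\mathbb R^d)$. **Theorem.** (i) Let $u\in\mathcal Lip_1(\Omega)$, $\mu\in\mathcal M^+(\Omega)$ and $\nu\in\mathcal M(\partial\Omega)$ satisfy $-\operatorname{div}(\mu D_\mu u)=\rho-\nu$ in $\mathbb R^d$, $|D_\mu u|=1$ $\mu$-a.e., $0\le u\le g$ on $\partial\Omega$, $u=0$ $\nu^-$-a.e. and $u=g$ $\nu^+$-a.e. Then $u$ is a maximizer of (max) and $(\mu D_\mu u,\nu)$ is a minimizer of (mincurrent). (ii) Conversely, let $u$ be a maximizer of (max), and let $\sigma\in\mathcal M(\overline\Omega,\mathbb R^d)$ and $\nu\in\mathcal M(\partial\Omega)$ satisfy $-\operatorname{div}\sigma=\rho-\nu$ in $\mathbb R^d$ and be optimal for (mincurrent), in the sense that $|\sigma|(\mathbb R^d)+\int_{\partial\Omega}g\,d\nu^+$ does not exceed the infimum (mincurrent). Put $\mu=|\sigma|$. Then $D_\mu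 u$ exists, $\sigma=\mu D_\mu u$ and $|D_\mu u|=1$ $\mu$-a.e. (for every field $w$ with $w=D_\mu u$ in the above sense), $u=0$ $\nu^-$-a.e. and $u=g$ $\nu^+$-a.e. -/

import Mathlib

open MeasureTheory Filter Topology
open scoped ContDiff InnerProductSpace ENNReal

noncomputable section

namespace Silo

/-- The Euclidean space `ℝ^d`. -/
abbrev Space (d : ℕ) : Type := EuclideanSpace ℝ (Fin d)

variable {d : ℕ}

/-- Smooth compactly supported real functions on `ℝ^d`. -/
def IsTestFun (φ : Space d → ℝ) : Prop := ContDiff ℝ ∞ φ ∧ HasCompactSupport φ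

/-! ## Tangential calculus with respect to a measure -/

/-- The space `X_η`: square integrable fields `ψ` such that `div (ψ η)` is a bounded measure, i.e.
`∫ Dφ · ψ dη ≤ K ‖φ‖_∞` for all test functions `φ`. -/
def IsTangentVectorField (η : Measure (Space d)) (ψ : Space d → Space d) : Prop :=
  MemLp ψ 2 η ∧ ∃ K : ℝ, ∀ φ : Space d → ℝ, IsTestFun φ →
    ∫ x, ⟪gradient φ x, ψ x⟫_ℝ ∂η ≤ K * ⨆ x, |φ x|

/-- `T` is the tangent space field `T_η`, the `η`-essential union of `X_η`: up to `η`-null sets it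
is the smallest closed-valued multifunction that has every element of `X_η` as a selection.
(The `η`-essential union exists, is linear-subspace-valued, and is unique `η`-a.e.) -/
structure IsTangentSpace (η : Measure (Space d)) (T : Space d → Submodule ℝ (Space d)) :
    Prop where
  mem : ∀ ψ, IsTangentVectorField η ψ → ∀ᵐ x ∂η, ψ x ∈ T x
  minimal : ∀ F : Space d → Set (Space d), (∀ x, IsClosed (F x)) →
    (∀ ψ, IsTangentVectorField η ψ → ∀ᵐ x ∂η, ψ x ∈ F x) →
    ∀ᵐ x ∂η, (T x : Set (Space d)) ⊆ F x

/-- `w = D_η v` in the tangential Sobolev space `H^1_η`: there are test functions `v_n` converging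
uniformly to `v` whose tangential gradients `P_η (D v_n)` converge to `w` weakly in `L²_η`, where
`P_η x` is the orthogonal projector onto `T_η x`. -/
def HasTangentialGradient (η : Measure (Space d)) (v : Space d → ℝ) (w : Space d → Space d) :
    Prop :=
  MemLp w 2 η ∧ ∃ T : Space d → Submodule ℝ (Space d), IsTangentSpace η T ∧
    ∃ vn : ℕ → Space d → ℝ, (∀ n, IsTestFun (vn n)) ∧ TendstoUniformly vn v atTop ∧
      ∀ ψ : Space d → Space d, MemLp ψ 2 η →
        Tendsto (fun n => ∫ x, ⟪(T x).starProjection (gradient (vn n) x), ψ x⟫_ℝ ∂η) atTop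
          (𝓝 (∫ x, ⟪w x, ψ x⟫_ℝ ∂η))

/-- `w = D_η u` for a function `u` on `closure Ω`, where `η` is carried by `closure Ω`: the
tangential gradient of a continuous compactly supported extension of `u` to `ℝ^d`. -/
def HasTangentialGradientOn (Ω : Set (Space d)) (η : Measure (Space d)) (u : Space d → ℝ)
    (w : Space d → Space d) : Prop :=
  ∃ v : Space d → ℝ, Continuous v ∧ HasCompactSupport v ∧ Set.EqOn v u (closure Ω) ∧
    HasTangentialGradient η v w

/-! ## The two optimization problems -/

/-- A real or vector valued Borel measure on `ℝ^d` belongs to `M(A)`: it is carried by `A`. -/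
def CarriedBy {V : Type*} [NormedAddCommGroup V] (σ : VectorMeasure (Space d) V)
    (A : Set (Space d)) : Prop :=
  σ.variation Aᶜ = 0

/-- The positive part `ν⁺` of the Jordan decomposition. -/
def posPart (ν : SignedMeasure (Space d)) : Measure (Space d) := ν.toJordanDecomposition.posPart

/-- The negative part `ν⁻` of the Jordan decomposition. -/
def negPart (ν : SignedMeasure (Space d)) : Measure (Space d) := ν.toJordanDecomposition.negPart

/-- `Lip_1(Ω)`: Lipschitz functions on `ℝ^d` that are `1`-Lipschitz on `closure Ω`. -/
def IsLipOne (Ω : Set (Space d)) (v : Space d → ℝ) : Prop :=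
  (∃ K, LipschitzWith K v) ∧ ∀ x ∈ closure Ω, ∀ y ∈ closure Ω, v y - v x ≤ ‖x - y‖

/-- Admissibility in the maximization problem. -/
def IsAdmissiblePotential (Ω : Set (Space d)) (g v : Space d → ℝ) : Prop :=
  IsLipOne Ω v ∧ ∀ x ∈ frontier Ω, 0 ≤ v x ∧ v x ≤ g x

/-- `u` maximizes `⟨ρ, v⟩` over all `v ∈ Lip_1(Ω)` with `0 ≤ v ≤ g` on the boundary. -/
def IsOptimalPotential (Ω : Set (Space d)) (g : Space d → ℝ) (ρ : SignedMeasure (Space d))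
    (u : Space d → ℝ) : Prop :=
  IsAdmissiblePotential Ω g u ∧
    ∀ v, IsAdmissiblePotential Ω g v → ∫ᵛ x, v x ∂•ρ ≤ ∫ᵛ x, u x ∂•ρ

/-- `- div σ = ρ - ν` in the sense of distributions in `ℝ^d`. -/
def IsDivSolution (σ : VectorMeasure (Space d) (Space d)) (ρ ν : SignedMeasure (Space d)) : Prop :=
  ∀ φ : Space d → ℝ, IsTestFun φ →
    ∫ᵛ x, gradient φ x ∂[innerSL ℝ; σ] = ∫ᵛ x, φ x ∂•(ρ - ν)

/-- `σ ∈ M(A, ℝ^d)`, `ν ∈ M(∂Ω)` and `- div σ = ρ - ν` in `ℝ^d`. -/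
def IsAdmissibleCurrent (Ω A : Set (Space d)) (ρ : SignedMeasure (Space d))
    (σ : VectorMeasure (Space d) (Space d)) (ν : SignedMeasure (Space d)) : Prop :=
  CarriedBy σ A ∧ CarriedBy ν (frontier Ω) ∧ IsDivSolution σ ρ ν

/-- The cost `|σ|(ℝ^d) + ∫_{∂Ω} g dν⁺`. -/
def currentCost (Ω : Set (Space d)) (g : Space d → ℝ)
    (σ : VectorMeasure (Space d) (Space d)) (ν : SignedMeasure (Space d)) : ℝ≥0∞ :=
  σ.variation Set.univ + ∫⁻ x in frontier Ω, ENNReal.ofReal (g x) ∂(posPart ν)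

/-- `(σ, ν) ∈ M(A, ℝ^d) × M(∂Ω)` is admissible and attains the infimum of the cost over all
admissible pairs of `M(Ω, ℝ^d) × M(∂Ω)`. -/
def IsOptimalCurrent (Ω A : Set (Space d)) (g : Space d → ℝ) (ρ : SignedMeasure (Space d))
    (σ : VectorMeasure (Space d) (Space d)) (ν : SignedMeasure (Space d)) : Prop :=
  IsAdmissibleCurrent Ω A ρ σ ν ∧
    ∀ σ' ν', IsAdmissibleCurrent Ω Ω ρ σ' ν' → currentCost Ω g σ ν ≤ currentCost Ω g σ' ν'

/-- `u = 0` holds `ν⁻`-a.e. and `u = g` holds `ν⁺`-a.e. -/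
def BoundaryComplementarity (g u : Space d → ℝ) (ν : SignedMeasure (Space d)) : Prop :=
  (∀ᵐ x ∂(negPart ν), u x = 0) ∧ ∀ᵐ x ∂(posPart ν), u x = g x

end Silo

end

/-! The two problems are dual to each other. For an admissible pair `(σ, ν)` and an admissible
potential `v`, ∫ v dρ = ∫ v d(ρ - ν) + ∫ v dν⁺ - ∫ v dν⁻. The first term is at most |σ|(ℝ^d),
because `v` is a uniform limit on the closure of Ω of test functions with gradient at most 1 there;
the others are at most ∫ g dν⁺ and 0. This is weak duality (`integral_potential_le_currentCost`).

Sufficiency: the field w = D_μ u solves a divergence equation, so it is tangential, and the weak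
convergence P_μ Dv_n ⇀ w tested against w itself gives ∫ u d(ρ - ν) = ∫ |w|² dμ = μ(ℝ^d)
(`integral_potential_of_hasTangentialGradientOn`). With complementarity, every inequality above is
an equality.

Necessity needs the absence of a duality gap (`exists_potential_without_gap`). The least cost of a
flow is a sublinear function of ρ; Hahn–Banach yields a linear functional `f` below it that touches
it at ρ. Comparison with currents along segments shows that x ↦ f(δ_x) is 1-Lipschitz, satisfies the
boundary bounds, and represents `f` by integration, so it is the required potential.

Without a gap the three inequalities are tight. Two give complementarity. The third says ∫ u d(ρ -
ν) = |σ|(ℝ^d); with the polar decomposition σ = ξ|σ| it forces ∫ |Dv_n - ξ|² d|σ| → 0 for the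
approximations v_n of `u`, so ξ is a tangential gradient of `u`
(`hasTangentialGradientOn_of_integral_eq`). Uniqueness of the tangential gradient
(`HasTangentialGradient.ae_eq`) transfers the conclusion to every such field. -/

noncomputable section

namespace Silo

variable {d : ℕ}

/-! ## Integrals with respect to vector measures -/

section VectorMeasureIntegral

variable {X E F G : Type*} [MeasurableSpace X] [NormedAddCommGroup E] [NormedSpace ℝ E]
  [NormedAddCommGroup F] [NormedSpace ℝ F] [NormedAddCommGroup G] [NormedSpace ℝ G]

instance isFiniteMeasure_variation (ρ : SignedMeasure X) : IsFiniteMeasure ρ.variation := by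
  rw [← SignedMeasure.totalVariation_eq_variation]; infer_instance

theorem integral_toSignedMeasure_smul (μ : Measure X) [IsFiniteMeasure μ] (f : X → ℝ) :
    ∫ᵛ x, f x ∂•μ.toSignedMeasure = ∫ x, f x ∂μ := by
  have h : (ContinuousLinearMap.lsmul ℝ ℝ : ℝ →L[ℝ] ℝ →L[ℝ] ℝ)
      = (ContinuousLinearMap.lsmul ℝ ℝ : ℝ →L[ℝ] ℝ →L[ℝ] ℝ).flip := by
    ext; simp
  rw [h, VectorMeasure.integral_toSignedMeasure]

theorem integral_eq_integral_jordan (ρ : SignedMeasure X) {f : X → ℝ}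
    (hp : Integrable f ρ.toJordanDecomposition.posPart)
    (hn : Integrable f ρ.toJordanDecomposition.negPart) :
    ∫ᵛ x, f x ∂•ρ = ∫ x, f x ∂ρ.toJordanDecomposition.posPart
      - ∫ x, f x ∂ρ.toJordanDecomposition.negPart := by
  conv_lhs => rw [← ρ.toSignedMeasure_toJordanDecomposition]
  unfold JordanDecomposition.toSignedMeasure
  rw [VectorMeasure.integral_sub_vectorMeasure, integral_toSignedMeasure_smul,
    integral_toSignedMeasure_smul]
  · simpa [VectorMeasure.Integrable] using hp
  · simpa [VectorMeasure.Integrable] using hn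

/-- Both sides are additive in `f` and agree on c·1_s, hence on simple functions; bounded simple
approximations and dominated convergence on each side do the rest. -/
theorem integral_vectorMeasure_withDensityᵥ [CompleteSpace F] [CompleteSpace G]
    (μ : Measure X) [IsFiniteMeasure μ]
    {w : X → F} (hw : Integrable w μ) (B : E →L[ℝ] F →L[ℝ] G) {f : X → E}
    (hf : StronglyMeasurable f) {C : ℝ} (hC : ∀ x, ‖f x‖ ≤ C) :
    ∫ᵛ x, f x ∂[B; μ.withDensityᵥ w] = ∫ x, B (f x) (w x) ∂μ := by
  have hvar := Measure.variation_withDensityᵥ hw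
  have : IsFiniteMeasure (μ.withDensityᵥ w).variation := by
    rw [hvar]; exact ⟨by simpa using! hw.2⟩
  have hB : ∀ (g : X → E), StronglyMeasurable g → ∀ D : ℝ, (∀ x, ‖g x‖ ≤ D) →
      Integrable (fun x => B (g x) (w x)) μ := by
    intro g hg D hD
    refine Integrable.mono' (hw.norm.const_mul (‖B‖ * D))
      (B.aestronglyMeasurable_comp₂ hg.aestronglyMeasurable hw.aestronglyMeasurable)
      (ae_of_all _ fun x => ?_)
    calc ‖B (g x) (w x)‖ ≤ ‖B‖ * ‖g x‖ * ‖w x‖ := B.le_opNorm₂ _ _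
      _ ≤ ‖B‖ * D * ‖w x‖ := by gcongr; exact hD x
  have hsimple : ∀ s : SimpleFunc X E,
      ∫ᵛ x, s x ∂[B; μ.withDensityᵥ w] = ∫ x, B (s x) (w x) ∂μ := by
    intro s
    induction s using SimpleFunc.induction with
    | const c hs =>
      rename_i s
      have : ∀ x, B ((SimpleFunc.piecewise s hs (SimpleFunc.const X c) (SimpleFunc.const X 0)) x)
          (w x) = s.indicator (fun x => B c (w x)) x := by
        intro x
        by_cases hx : x ∈ s <;> simp [hx]
      simp_rw [this]
      rw [integral_indicator hs]
      have h2 : ∀ x, (SimpleFunc.piecewise s hs (SimpleFunc.const X c) (SimpleFunc.const X 0)) x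
          = s.indicator (fun _ => c) x := by
        intro x
        by_cases hx : x ∈ s <;> simp [hx]
      simp_rw [h2]
      rw [VectorMeasure.integral_indicator hs, VectorMeasure.setIntegral_const,
        withDensityᵥ_apply hw hs, ContinuousLinearMap.integral_comp_comm _ hw.integrableOn]
    | @add f g hd hf hg =>
      obtain ⟨Cf, hCf⟩ := f.exists_forall_norm_le
      obtain ⟨Cg, hCg⟩ := g.exists_forall_norm_le
      simp only [SimpleFunc.coe_add, Pi.add_apply, map_add, add_apply]
      rw [VectorMeasure.integral_fun_add (Integrable.of_bound f.aestronglyMeasurable Cf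
          (ae_of_all _ hCf)) (Integrable.of_bound g.aestronglyMeasurable Cg
          (ae_of_all _ hCg)), hf, hg, integral_add (hB f f.stronglyMeasurable Cf hCf)
          (hB g g.stronglyMeasurable Cg hCg)]
  by_cases hX : Nonempty X
  swap
  · rw [not_nonempty_iff] at hX
    simp [VectorMeasure.integral_of_isEmpty, Measure.eq_zero_of_isEmpty μ]
  have hC0 : 0 ≤ C := (norm_nonneg _).trans (hC hX.some)
  have hlim : ∀ x, Tendsto (fun n => hf.approxBounded C n x) atTop (𝓝 (f x)) :=
    fun x => hf.tendsto_approxBounded_of_norm_le (hC x)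
  have hbd : ∀ n x, ‖hf.approxBounded C n x‖ ≤ C := fun n x => hf.norm_approxBounded_le hC0 n x
  have h1 : Tendsto (fun n => ∫ᵛ x, hf.approxBounded C n x ∂[B; μ.withDensityᵥ w]) atTop
      (𝓝 (∫ᵛ x, f x ∂[B; μ.withDensityᵥ w])) :=
    VectorMeasure.tendsto_integral_of_dominated_convergence
    (fun _ => C) (fun n => (hf.approxBounded C n).aestronglyMeasurable) (integrable_const _)
    (fun n => ae_of_all _ (hbd n)) (ae_of_all _ hlim)
  have h2 : Tendsto (fun n => ∫ x, B (hf.approxBounded C n x) (w x) ∂μ) atTop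
      (𝓝 (∫ x, B (f x) (w x) ∂μ)) := by
    refine tendsto_integral_of_dominated_convergence (fun x => ‖B‖ * C * ‖w x‖)
      (fun n => (hB _ (hf.approxBounded C n).stronglyMeasurable C (hbd n)).aestronglyMeasurable)
      (hw.norm.const_mul _) (fun n => ae_of_all _ fun x => ?_) (ae_of_all _ fun x => ?_)
    · calc ‖B (hf.approxBounded C n x) (w x)‖ ≤ ‖B‖ * ‖hf.approxBounded C n x‖ * ‖w x‖ :=
            B.le_opNorm₂ _ _
        _ ≤ ‖B‖ * C * ‖w x‖ := by gcongr; exact hbd n x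
    · exact ((B.flip (w x)).continuous.tendsto _).comp (hlim x)
  simp_rw [hsimple] at h1
  exact tendsto_nhds_unique h1 h2

end VectorMeasureIntegral

/-! ## Polar decomposition -/

/-- The coordinates of σ are absolutely continuous with respect to |σ|, and their Radon–Nikodym
derivatives form ξ. Comparing variations, |σ| = |ξ| |σ|, so |ξ| = 1 a.e. -/
theorem exists_polar_decomposition {X : Type*} [MeasurableSpace X]
    (σ : VectorMeasure X (Space d)) [IsFiniteMeasure σ.variation] :
    ∃ ξ : X → Space d, Integrable ξ σ.variation ∧ (∀ᵐ x ∂σ.variation, ‖ξ x‖ = 1) ∧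
      σ = σ.variation.withDensityᵥ ξ := by
  set μ := σ.variation with hμ
  let s : Fin d → SignedMeasure X := fun i =>
    σ.mapRange (EuclideanSpace.proj (𝕜 := ℝ) i).toLinearMap.toAddMonoidHom
      (EuclideanSpace.proj (𝕜 := ℝ) i).continuous
  have hs : ∀ i A, s i A = σ A i := fun i A => rfl
  have hac : ∀ i, s i ≪ᵥ μ.toENNRealVectorMeasure := by
    intro i
    refine VectorMeasure.AbsolutelyContinuous.mk fun A hA h0 => ?_
    rw [Measure.toENNRealVectorMeasure_apply_measurable hA] at h0
    rw [hs, (VectorMeasure.variation_apply_eq_zero hA).1 h0 A subset_rfl hA]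
    rfl
  let ξ : X → Space d := fun x => WithLp.toLp 2 fun i => (s i).rnDeriv μ x
  have hint : Integrable ξ μ := by
    refine Integrable.of_eval_piLp fun i => ?_
    exact SignedMeasure.integrable_rnDeriv (s i) μ
  have hσ : σ = μ.withDensityᵥ ξ := by
    ext A hA i
    rw [withDensityᵥ_apply hint hA, eval_integral_piLp (fun i => (hint.eval_piLp i).integrableOn),
      ← hs, ← SignedMeasure.withDensityᵥ_rnDeriv_eq (s i) μ (hac i),
      withDensityᵥ_apply (SignedMeasure.integrable_rnDeriv (s i) μ) hA]
  refine ⟨ξ, hint, ?_, hσ⟩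
  have h1 : μ.withDensity (fun x => ‖ξ x‖ₑ) = μ.withDensity 1 := by
    rw [← Measure.variation_withDensityᵥ hint, ← hσ, withDensity_one]
  have h2 := (withDensity_eq_iff_of_sigmaFinite hint.aestronglyMeasurable.enorm
    aemeasurable_one).1 h1
  filter_upwards [h2] with x hx
  rw [← toReal_enorm, hx, ENNReal.toReal_one]

/-! ## Smooth approximation of Lipschitz functions -/

/-- Mollification by a normalized bump of radius ε: averaging translates keeps the Lipschitz
constant and moves the values by at most ε. -/
theorem exists_contDiff_lipschitzWith_dist_le {E : Type*} [NormedAddCommGroup E] [NormedSpace ℝ E]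
    [FiniteDimensional ℝ E] {f : E → ℝ} (hf : LipschitzWith 1 f) {ε : ℝ} (hε : 0 < ε) :
    ∃ g : E → ℝ, ContDiff ℝ ∞ g ∧ LipschitzWith 1 g ∧ ∀ x, dist (g x) (f x) ≤ ε := by
  borelize E
  let φ : ContDiffBump (0 : E) := ⟨ε / 2, ε, half_pos hε, half_lt_self hε⟩
  let η : Measure E := Measure.addHaar
  have hlip : ∀ x y, |f x - f y| ≤ ‖x - y‖ := fun x y => by
    simpa [Real.dist_eq, dist_eq_norm] using hf.dist_le_mul x y
  refine ⟨_, (φ.hasCompactSupport_normed (μ := η)).contDiff_convolution_left (.lsmul ℝ ℝ)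
    φ.contDiff_normed (hf.continuous.locallyIntegrable (μ := η)), ?_, fun x => ?_⟩
  · refine LipschitzWith.of_dist_le_mul fun x y => ?_
    have hint : ∀ x, Integrable (fun t => φ.normed η t • f (x - t)) η := fun x =>
      (φ.continuous_normed.smul (hf.continuous.comp (by fun_prop))).integrable_of_hasCompactSupport
        φ.hasCompactSupport_normed.smul_right
    simp only [convolution, ContinuousLinearMap.lsmul_apply, NNReal.coe_one, one_mul]
    rw [Real.dist_eq, ← integral_sub (hint x) (hint y), ← Real.norm_eq_abs]
    calc ‖∫ t, (φ.normed η t • f (x - t) - φ.normed η t • f (y - t)) ∂η‖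
        ≤ ∫ t, φ.normed η t * dist x y ∂η := by
          refine norm_integral_le_of_norm_le (φ.integrable_normed.mul_const _)
            (ae_of_all _ fun t => ?_)
          rw [← smul_sub, norm_smul, Real.norm_of_nonneg (φ.nonneg_normed t)]
          refine mul_le_mul_of_nonneg_left ?_ (φ.nonneg_normed t)
          simpa [dist_eq_norm] using hlip (x - t) (y - t)
      _ = dist x y := by rw [integral_mul_const, φ.integral_normed, one_mul]
  · refine φ.dist_normed_convolution_le hf.continuous.aestronglyMeasurable fun y hy => ?_
    have := hf.dist_le_mul y x
    rw [NNReal.coe_one, one_mul] at this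
    exact this.trans (Metric.mem_ball.1 hy).le

theorem exists_cutoff {K U : Set (Space d)} (hK : IsCompact K) (hU : IsOpen U) (hKU : K ⊆ U) :
    ∃ χ : Space d → ℝ, IsTestFun χ ∧ (∀ᶠ x in 𝓝ˢ K, χ x = 1) ∧ (∀ x ∉ U, χ x = 0) ∧
      ∀ x, χ x ∈ Set.Icc (0 : ℝ) 1 := by
  obtain ⟨L, hL, hKL, hLU⟩ := exists_compact_between hK hU hKU
  obtain ⟨f, h1, h0, hf⟩ := exists_contMDiffMap_one_nhds_of_subset_interior
    (n := ⊤) (modelWithCornersSelf ℝ (Space d)) hK.isClosed hKL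
  refine ⟨f, ⟨f.contMDiff.contDiff, HasCompactSupport.intro hL h0⟩, h1,
    fun x hx => h0 x fun h => hx (hLU h), hf⟩

theorem norm_gradient_le_of_lipschitz {f : Space d → ℝ} (hf : LipschitzWith 1 f) (x : Space d) :
    ‖gradient f x‖ ≤ 1 := by
  rw [gradient, LinearIsometryEquiv.norm_map]
  simpa using norm_fderiv_le_of_lipschitz ℝ hf (x₀ := x)

theorem IsTestFun.continuous_gradient {φ : Space d → ℝ} (hφ : IsTestFun φ) :
    Continuous (gradient φ) :=
  (InnerProductSpace.toDual ℝ (Space d)).symm.continuous.comp (hφ.1.continuous_fderiv (by simp))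

theorem IsTestFun.exists_norm_gradient_le {φ : Space d → ℝ} (hφ : IsTestFun φ) :
    ∃ C, ∀ x, ‖gradient φ x‖ ≤ C := by
  have h : HasCompactSupport (gradient φ) := by
    refine (hφ.2.fderiv ℝ).comp_left (g := (InnerProductSpace.toDual ℝ (Space d)).symm) ?_
    simp
  exact h.exists_bound_of_continuous hφ.continuous_gradient

theorem IsTestFun.exists_abs_le {φ : Space d → ℝ} (hφ : IsTestFun φ) : ∃ C, ∀ x, |φ x| ≤ C :=
  hφ.2.exists_bound_of_continuous hφ.1.continuous

theorem IsTestFun.mul {φ ψ : Space d → ℝ} (hφ : IsTestFun φ) (hψ : IsTestFun ψ) :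
    IsTestFun fun x => φ x * ψ x :=
  ⟨hφ.1.mul hψ.1, hφ.2.mul_right⟩

theorem IsTestFun.differentiableAt {φ : Space d → ℝ} (hφ : IsTestFun φ) (x : Space d) :
    DifferentiableAt ℝ φ x :=
  hφ.1.differentiable (by simp) x

theorem gradient_mul {φ ψ : Space d → ℝ} {x : Space d} (hφ : DifferentiableAt ℝ φ x)
    (hψ : DifferentiableAt ℝ ψ x) :
    gradient (fun y => φ y * ψ y) x = φ x • gradient ψ x + ψ x • gradient φ x := by
  simp only [gradient]
  rw [fderiv_fun_mul hφ hψ, map_add, map_smul, map_smul]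

theorem gradient_mul_of_eventually_one {χ φ : Space d → ℝ} {x : Space d}
    (h : ∀ᶠ y in 𝓝 x, χ y = 1) : gradient (fun y => χ y * φ y) x = gradient φ x := by
  simp only [gradient]
  congr 1
  refine Filter.EventuallyEq.fderiv_eq ?_
  filter_upwards [h] with y hy
  rw [hy, one_mul]

/-- A function that is `1`-Lipschitz on a compact set `S` has a compactly supported continuous
extension that is a uniform limit of test functions with gradient at most `1` on `S`. -/
theorem exists_test_approx {S : Set (Space d)} (hS : IsCompact S) {u : Space d → ℝ}
    (hu : LipschitzOnWith 1 u S) :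
    ∃ v : Space d → ℝ, Continuous v ∧ HasCompactSupport v ∧ Set.EqOn v u S ∧
      ∃ vn : ℕ → Space d → ℝ, (∀ n, IsTestFun (vn n)) ∧ TendstoUniformly vn v atTop ∧
        ∀ n, ∀ x ∈ S, ‖gradient (vn n) x‖ ≤ 1 := by
  obtain ⟨f, hf, huf⟩ := hu.extend_real
  obtain ⟨χ, hχ, h1, -, h01⟩ := exists_cutoff hS isOpen_univ (Set.subset_univ S)
  have hpos : ∀ n : ℕ, (0 : ℝ) < 1 / ((n : ℝ) + 1) := fun n => by positivity
  choose g hg hgl hgf using fun n : ℕ => exists_contDiff_lipschitzWith_dist_le hf (hpos n)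
  refine ⟨fun x => χ x * f x, hχ.1.continuous.mul hf.continuous, hχ.2.mul_right, fun x hx => ?_,
    fun n x => χ x * g n x, fun n => ⟨hχ.1.mul (hg n), hχ.2.mul_right⟩, ?_, fun n x hx => ?_⟩
  · simp only [h1.self_of_nhdsSet x hx, one_mul]
    exact (huf hx).symm
  · rw [Metric.tendstoUniformly_iff]
    intro ε hε
    filter_upwards [tendsto_one_div_add_atTop_nhds_zero_nat.eventually (gt_mem_nhds hε)] with n hn x
    rw [dist_comm, Real.dist_eq, ← mul_sub, abs_mul, abs_of_nonneg (h01 x).1]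
    calc χ x * |g n x - f x| ≤ 1 * (1 / ((n : ℝ) + 1)) := by
          gcongr
          · exact (h01 x).2
          · exact hgf n x
      _ < ε := by rwa [one_mul]
  -- The cutoff is 1 in a neighbourhood of S, so it leaves the gradient unchanged on S; the bound 1
  -- is not claimed elsewhere.
  · rw [gradient_mul_of_eventually_one (h1.filter_mono (nhds_le_nhdsSet hx))]
    exact norm_gradient_le_of_lipschitz (hgl n) x

/-! ## Weak duality -/

theorem CarriedBy.mono {V : Type*} [NormedAddCommGroup V] {σ : VectorMeasure (Space d) V}
    {A B : Set (Space d)} (h : CarriedBy σ A) (hAB : A ⊆ B) : CarriedBy σ B :=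
  measure_mono_null (Set.compl_subset_compl.2 hAB) h

theorem CarriedBy.ae_mem {V : Type*} [NormedAddCommGroup V] {σ : VectorMeasure (Space d) V}
    {A : Set (Space d)} (h : CarriedBy σ A) : ∀ᵐ x ∂σ.variation, x ∈ A :=
  h

theorem CarriedBy.add {V : Type*} [NormedAddCommGroup V] {σ τ : VectorMeasure (Space d) V}
    {A : Set (Space d)} (h : CarriedBy σ A) (h' : CarriedBy τ A) : CarriedBy (σ + τ) A := by
  refine le_antisymm ((VectorMeasure.variation_add_le _).trans ?_) (zero_le)
  rw [Measure.add_apply, h, h', add_zero]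

theorem CarriedBy.neg {V : Type*} [NormedAddCommGroup V] {σ : VectorMeasure (Space d) V}
    {A : Set (Space d)} (h : CarriedBy σ A) : CarriedBy (-σ) A := by
  rwa [CarriedBy, VectorMeasure.variation_neg]

theorem CarriedBy.sub {V : Type*} [NormedAddCommGroup V] {σ τ : VectorMeasure (Space d) V}
    {A : Set (Space d)} (h : CarriedBy σ A) (h' : CarriedBy τ A) : CarriedBy (σ - τ) A := by
  rw [sub_eq_add_neg]; exact h.add h'.neg

theorem variation_eq_posPart_add_negPart (ν : SignedMeasure (Space d)) :
    ν.variation = posPart ν + negPart ν :=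
  (SignedMeasure.totalVariation_eq_variation ν).symm

instance (ν : SignedMeasure (Space d)) : IsFiniteMeasure (posPart ν) := by
  unfold posPart; infer_instance

instance (ν : SignedMeasure (Space d)) : IsFiniteMeasure (negPart ν) := by
  unfold negPart; infer_instance

theorem CarriedBy.posPart {ν : SignedMeasure (Space d)} {A : Set (Space d)} (h : CarriedBy ν A) :
    ∀ᵐ x ∂posPart ν, x ∈ A := by
  have := h.ae_mem
  rw [variation_eq_posPart_add_negPart, ae_add_measure_iff] at this
  exact this.1

theorem CarriedBy.negPart {ν : SignedMeasure (Space d)} {A : Set (Space d)} (h : CarriedBy ν A) :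
    ∀ᵐ x ∂negPart ν, x ∈ A := by
  have := h.ae_mem
  rw [variation_eq_posPart_add_negPart, ae_add_measure_iff] at this
  exact this.2

theorem integrable_of_continuous_of_ae_mem {μ : Measure (Space d)} [IsFiniteMeasure μ]
    {S : Set (Space d)} (hS : IsCompact S) (h : ∀ᵐ x ∂μ, x ∈ S) {f : Space d → ℝ}
    (hf : Continuous f) : Integrable f μ := by
  rw [← Measure.restrict_eq_self_of_ae_mem h]
  exact hf.continuousOn.integrableOn_compact hS

/-- Pairing with a signed measure carried by `S` is continuous for uniform convergence on `S`. -/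
theorem tendsto_integral_of_tendstoUniformly {S : Set (Space d)} {ρ : SignedMeasure (Space d)}
    (hρ : CarriedBy ρ S) {v u : Space d → ℝ} (hv : Continuous v) (hvc : HasCompactSupport v)
    (hvu : Set.EqOn v u S) {vn : ℕ → Space d → ℝ} (hvn : ∀ n, IsTestFun (vn n))
    (hlim : TendstoUniformly vn v atTop) :
    Tendsto (fun n => ∫ᵛ x, vn n x ∂•ρ) atTop (𝓝 (∫ᵛ x, u x ∂•ρ)) := by
  obtain ⟨C, hC⟩ := hvc.exists_bound_of_continuous hv
  refine VectorMeasure.tendsto_integral_filter_of_norm_le_const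
    (Eventually.of_forall fun n => (hvn n).1.continuous.aestronglyMeasurable) ⟨C + 1, ?_⟩ ?_
  · filter_upwards [Metric.tendstoUniformly_iff.1 hlim 1 one_pos] with n hn
    refine ae_of_all _ fun x => ?_
    have h1 := hn x
    rw [dist_comm, dist_eq_norm] at h1
    calc ‖vn n x‖ = ‖v x + (vn n x - v x)‖ := by rw [add_sub_cancel]
      _ ≤ ‖v x‖ + ‖vn n x - v x‖ := norm_add_le _ _
      _ ≤ C + 1 := add_le_add (hC x) h1.le
  · filter_upwards [hρ.ae_mem] with x hx
    rw [← hvu hx]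
    exact hlim.tendsto_at x

theorem IsLipOne.lipschitzOnWith {Ω : Set (Space d)} {v : Space d → ℝ} (hv : IsLipOne Ω v) :
    LipschitzOnWith 1 v (closure Ω) := by
  refine LipschitzOnWith.of_dist_le_mul fun x hx y hy => ?_
  rw [NNReal.coe_one, one_mul, Real.dist_eq, dist_eq_norm, abs_le]
  constructor
  · linarith [hv.2 x hx y hy]
  · linarith [hv.2 y hy x hx, norm_sub_rev x y]

theorem IsLipOne.continuous {Ω : Set (Space d)} {v : Space d → ℝ} (hv : IsLipOne Ω v) :
    Continuous v := hv.1.choose_spec.continuous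

/-- Test functions with gradient at most 1 on the closure of Ω, which carries σ, satisfy the bound
by the divergence equation; it passes to the uniform limit. -/
theorem integral_sub_le_variation {Ω : Set (Space d)} (hΩb : Bornology.IsBounded Ω)
    {ρ ν : SignedMeasure (Space d)} (hρ : CarriedBy ρ (closure Ω)) (hν : CarriedBy ν (closure Ω))
    {σ : VectorMeasure (Space d) (Space d)} [IsFiniteMeasure σ.variation]
    (hσ : CarriedBy σ (closure Ω)) (hdiv : IsDivSolution σ ρ ν) {u : Space d → ℝ}
    (hu : IsLipOne Ω u) :
    ∫ᵛ x, u x ∂•(ρ - ν) ≤ σ.variation.real Set.univ := by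
  obtain ⟨v, hv, hvc, hvu, vn, hvn, hlim, hgr⟩ :=
    exists_test_approx hΩb.isCompact_closure hu.lipschitzOnWith
  have h := tendsto_integral_of_tendstoUniformly (hρ.sub hν) hv hvc hvu hvn hlim
  refine le_of_tendsto h (Eventually.of_forall fun n => ?_)
  rw [← hdiv _ (hvn n)]
  refine (Real.le_norm_self _).trans ((VectorMeasure.norm_integral_le_of_norm_le_const (C := 1) ?_).trans
    ?_)
  · filter_upwards [hσ.ae_mem] with x hx using hgr n x hx
  · rw [one_mul]
    exact mul_le_of_le_one_left measureReal_nonneg (norm_innerSL_le ℝ)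

/-! ## The cost of a current -/

theorem integral_sub_signed {S : Set (Space d)} (hS : IsCompact S)
    {ρ ν : SignedMeasure (Space d)} (hρ : CarriedBy ρ S) (hν : CarriedBy ν S) {u : Space d → ℝ}
    (hu : Continuous u) :
    ∫ᵛ x, u x ∂•(ρ - ν) = ∫ᵛ x, u x ∂•ρ - ∫ᵛ x, u x ∂•ν :=
  VectorMeasure.integral_sub_vectorMeasure (integrable_of_continuous_of_ae_mem hS hρ.ae_mem hu)
    (integrable_of_continuous_of_ae_mem hS hν.ae_mem hu)

theorem integral_signed_eq {S : Set (Space d)} (hS : IsCompact S)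
    {ν : SignedMeasure (Space d)} (hν : CarriedBy ν S) {u : Space d → ℝ}
    (hu : Continuous u) :
    ∫ᵛ x, u x ∂•ν = ∫ x, u x ∂posPart ν - ∫ x, u x ∂negPart ν :=
  integral_eq_integral_jordan ν (integrable_of_continuous_of_ae_mem hS hν.posPart hu)
    (integrable_of_continuous_of_ae_mem hS hν.negPart hu)

/-- Semicontinuity supplies measurability on the boundary, and the two-sided bound on `g` supplies
integrability. -/
theorem integrable_boundary_cost {Ω : Set (Space d)} {g : Space d → ℝ}
    (hg0 : ∀ x ∈ frontier Ω, 0 ≤ g x)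
    (hgb : BddAbove (g '' frontier Ω)) (hgl : LowerSemicontinuousOn g (frontier Ω))
    {μ : Measure (Space d)} [IsFiniteMeasure μ] (hμ : ∀ᵐ x ∂μ, x ∈ frontier Ω) :
    Integrable g μ := by
  obtain ⟨M, hM⟩ := hgb
  refine Integrable.of_bound (C := M) ?_ ?_
  · rw [← Measure.restrict_eq_self_of_ae_mem hμ]
    refine AEMeasurable.aestronglyMeasurable
      (aemeasurable_restrict_of_measurable_subtype isClosed_frontier.measurableSet ?_)
    exact LowerSemicontinuous.measurable (lowerSemicontinuous_restrict_iff.2 hgl)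
  · filter_upwards [hμ] with x hx
    rw [Real.norm_of_nonneg (hg0 x hx)]
    exact hM ⟨x, hx, rfl⟩

theorem currentCost_eq {Ω : Set (Space d)} {g : Space d → ℝ}
    (hg0 : ∀ x ∈ frontier Ω, 0 ≤ g x)
    (hgb : BddAbove (g '' frontier Ω)) (hgl : LowerSemicontinuousOn g (frontier Ω))
    {σ : VectorMeasure (Space d) (Space d)} [IsFiniteMeasure σ.variation]
    {ν : SignedMeasure (Space d)} (hν : CarriedBy ν (frontier Ω)) :
    currentCost Ω g σ ν
      = ENNReal.ofReal (σ.variation.real Set.univ + ∫ x, g x ∂posPart ν) := by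
  have h0 : 0 ≤ᵐ[posPart ν] g := by filter_upwards [hν.posPart] with x hx using hg0 x hx
  rw [currentCost, Measure.restrict_eq_self_of_ae_mem hν.posPart,
    ENNReal.ofReal_add measureReal_nonneg (integral_nonneg_of_ae h0),
    ofReal_integral_eq_lintegral_ofReal (integrable_boundary_cost hg0 hgb hgl hν.posPart) h0,
    Measure.real, ENNReal.ofReal_toReal (measure_ne_top _ _)]

theorem isFiniteMeasure_variation_of_currentCost_ne_top {Ω : Set (Space d)} {g : Space d → ℝ}
    {σ : VectorMeasure (Space d) (Space d)} {ν : SignedMeasure (Space d)}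
    (h : currentCost Ω g σ ν ≠ ⊤) : IsFiniteMeasure σ.variation :=
  ⟨lt_of_le_of_lt le_self_add (lt_top_iff_ne_top.2 h)⟩

section Duality

variable {Ω : Set (Space d)} (hΩb : Bornology.IsBounded Ω)
  {g : Space d → ℝ} (hg0 : ∀ x ∈ frontier Ω, 0 ≤ g x)
  (hgb : BddAbove (g '' frontier Ω)) (hgl : LowerSemicontinuousOn g (frontier Ω))
  {ρ : SignedMeasure (Space d)} (hρ : CarriedBy ρ (closure Ω))

include hΩb in
theorem isCompact_frontier_of_isBounded : IsCompact (frontier Ω) :=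
  hΩb.isCompact_closure.of_isClosed_subset isClosed_frontier frontier_subset_closure

include hΩb hg0 hgb hgl in
theorem integral_boundary_le {v : Space d → ℝ} (hv : IsAdmissiblePotential Ω g v)
    {ν : SignedMeasure (Space d)} (hν : CarriedBy ν (frontier Ω)) :
    ∫ x, v x ∂posPart ν ≤ ∫ x, g x ∂posPart ν ∧ 0 ≤ ∫ x, v x ∂negPart ν := by
  constructor
  · refine integral_mono_ae (integrable_of_continuous_of_ae_mem
      (isCompact_frontier_of_isBounded hΩb) hν.posPart hv.1.continuous)
      (integrable_boundary_cost hg0 hgb hgl hν.posPart) ?_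
    filter_upwards [hν.posPart] with x hx using (hv.2 x hx).2
  · refine integral_nonneg_of_ae ?_
    filter_upwards [hν.negPart] with x hx using (hv.2 x hx).1

include hΩb hρ in
theorem integral_potential_eq {v : Space d → ℝ} (hv : Continuous v)
    {ν : SignedMeasure (Space d)} (hν : CarriedBy ν (frontier Ω)) :
    ∫ᵛ x, v x ∂•ρ = ∫ᵛ x, v x ∂•(ρ - ν) + ∫ x, v x ∂posPart ν - ∫ x, v x ∂negPart ν := by
  rw [integral_sub_signed hΩb.isCompact_closure hρ (hν.mono frontier_subset_closure) hv,
    integral_signed_eq hΩb.isCompact_closure (hν.mono frontier_subset_closure) hv]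
  ring

include hΩb hg0 hgb hgl hρ in
theorem integral_potential_le_currentCost {v : Space d → ℝ} (hv : IsAdmissiblePotential Ω g v)
    {σ : VectorMeasure (Space d) (Space d)} {ν : SignedMeasure (Space d)}
    (h : IsAdmissibleCurrent Ω (closure Ω) ρ σ ν) :
    ENNReal.ofReal (∫ᵛ x, v x ∂•ρ) ≤ currentCost Ω g σ ν := by
  by_cases htop : currentCost Ω g σ ν = ⊤
  · rw [htop]; exact le_top
  have := isFiniteMeasure_variation_of_currentCost_ne_top htop
  rw [currentCost_eq hg0 hgb hgl h.2.1]
  refine ENNReal.ofReal_le_ofReal ?_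
  have h1 := integral_sub_le_variation hΩb hρ (h.2.1.mono frontier_subset_closure) h.1 h.2.2 hv.1
  have h2 := integral_boundary_le hΩb hg0 hgb hgl hv h.2.1
  rw [integral_potential_eq hΩb hρ hv.1.continuous h.2.1]
  linarith [h2.1, h2.2]

include hΩb hg0 hgb hgl hρ in
/-- Absence of a duality gap forces the complementarity conditions. -/
theorem complementarity_of_currentCost_le {u : Space d → ℝ} (hu : IsAdmissiblePotential Ω g u)
    {σ : VectorMeasure (Space d) (Space d)} {ν : SignedMeasure (Space d)}
    [IsFiniteMeasure σ.variation]
    (h : IsAdmissibleCurrent Ω (closure Ω) ρ σ ν)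
    (hgap : σ.variation.real Set.univ + ∫ x, g x ∂posPart ν ≤ ∫ᵛ x, u x ∂•ρ) :
    ∫ᵛ x, u x ∂•(ρ - ν) = σ.variation.real Set.univ ∧ BoundaryComplementarity g u ν := by
  have h1 := integral_sub_le_variation hΩb hρ (h.2.1.mono frontier_subset_closure) h.1 h.2.2 hu.1
  have h2 := integral_boundary_le hΩb hg0 hgb hgl hu h.2.1
  have hfr := isCompact_frontier_of_isBounded hΩb
  rw [integral_potential_eq hΩb hρ hu.1.continuous h.2.1] at hgap
  have hup := integrable_of_continuous_of_ae_mem hfr h.2.1.posPart hu.1.continuous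
  have hun := integrable_of_continuous_of_ae_mem hfr h.2.1.negPart hu.1.continuous
  have hgi := integrable_boundary_cost hg0 hgb hgl h.2.1.posPart
  -- The three inequalities of weak duality add up to an equality, so each one is an equality; the
  -- last two are integrals of nonnegative functions that vanish.
  refine ⟨by linarith [h2.1, h2.2], ?_, ?_⟩
  · refine (integral_eq_zero_iff_of_nonneg_ae ?_ hun).1 (by linarith [h2.1, h2.2])
    filter_upwards [h.2.1.negPart] with x hx using (hu.2 x hx).1
  · have h3 : ∫ x, (g x - u x) ∂posPart ν = 0 := by
      rw [integral_sub hgi hup]; linarith [h2.1, h2.2]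
    have h4 := (integral_eq_zero_iff_of_nonneg_ae ?_ (hgi.sub hup)).1 h3
    · filter_upwards [h4] with x hx
      exact (sub_eq_zero.1 hx).symm
    · filter_upwards [h.2.1.posPart] with x hx using sub_nonneg.2 (hu.2 x hx).2

end Duality

/-! ## Measurability of projections onto spans of countably many fields -/

open InnerProductSpace in
-- The projection onto a line is an explicit quotient, which is 0 for the zero vector by the
-- convention on division by zero. Linear dependence therefore needs no case distinction.
theorem measurable_gramSchmidt {X : Type*} [MeasurableSpace X] {f : ℕ → X → Space d}
    (hf : ∀ k, Measurable (f k)) (n : ℕ) :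
    Measurable fun x => gramSchmidt ℝ (fun k => f k x) n := by
  induction n using Nat.strong_induction_on with
  | _ n ih =>
    simp_rw [gramSchmidt_def ℝ _ n, Submodule.starProjection_singleton]
    refine (hf n).sub (Finset.measurable_fun_sum _ fun i hi => ?_)
    have hi' := ih i (Finset.mem_Iio.1 hi)
    exact ((hi'.inner (hf n)).div (hi'.norm.pow_const 2)).smul hi'

open InnerProductSpace in
-- In finite dimension the increasing spans of the first n orthogonalized vectors stabilize, so the
-- sequence is eventually constant. This exhibits the projector as a pointwise limit of measurable
-- expressions.
theorem tendsto_sum_starProjection_gramSchmidt (f : ℕ → Space d) (y : Space d) :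
    Tendsto (fun n => ∑ i ∈ Finset.range n, (Submodule.span ℝ {gramSchmidt ℝ f i}).starProjection y)
      atTop (𝓝 ((Submodule.span ℝ (Set.range f)).starProjection y)) := by
  set e := gramSchmidt ℝ f with he
  have hspan : Submodule.span ℝ (Set.range f) = Submodule.span ℝ (Set.range e) :=
    (span_gramSchmidt ℝ f).symm
  let V : ℕ →o Submodule ℝ (Space d) :=
    ⟨fun n => Submodule.span ℝ (e '' Set.Iio n), fun m n h =>
      Submodule.span_mono (Set.image_mono (Set.Iio_subset_Iio h))⟩
  obtain ⟨n₀, hn₀⟩ := monotone_stabilizes_iff_noetherian.2 (inferInstance : IsNoetherian ℝ (Space d)) V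
  have hV : ∀ n, n₀ ≤ n → Submodule.span ℝ (Set.range f) = V n := by
    intro n hn
    rw [hspan]
    refine le_antisymm (Submodule.span_le.2 ?_) (Submodule.span_mono (Set.image_subset_range _ _))
    rintro _ ⟨k, rfl⟩
    have h1 : e k ∈ V (max n (k + 1)) :=
      Submodule.subset_span ⟨k, lt_of_lt_of_le (Nat.lt_succ_self k) (le_max_right _ _), rfl⟩
    rwa [← hn₀ _ (hn.trans (le_max_left _ _)), hn₀ _ hn] at h1
  refine tendsto_const_nhds.congr' ?_
  filter_upwards [eventually_ge_atTop n₀] with n hn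
  symm
  refine Submodule.eq_starProjection_of_mem_of_inner_eq_zero ?_ ?_ |>.symm
  · refine Submodule.sum_mem _ fun i _ => ?_
    rw [hspan]
    refine Submodule.span_mono (Set.singleton_subset_iff.2 (Set.mem_range_self i))
      (Submodule.starProjection_apply_mem _ _)
  · rw [hV n hn]
    intro z hz
    induction hz using Submodule.span_induction with
    | zero => simp
    | add a b _ _ ha hb => rw [inner_add_right, ha, hb, add_zero]
    | smul c a _ ha => rw [inner_smul_right, ha, mul_zero]
    | mem z hz =>
      obtain ⟨k, hk, rfl⟩ := hz
      rw [inner_sub_left, sum_inner, Finset.sum_eq_single k]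
      · rw [Submodule.inner_starProjection_left_eq_right,
          Submodule.starProjection_eq_self_iff.2 (Submodule.mem_span_singleton_self _), sub_self]
      · intro i _ hik
        rw [Submodule.starProjection_singleton, inner_smul_left,
          gramSchmidt_orthogonal ℝ f hik, mul_zero]
      · intro hk'
        exact absurd (Finset.mem_range.2 hk) hk'

theorem stronglyMeasurable_starProjection_span {X : Type*} [MeasurableSpace X]
    {f : ℕ → X → Space d} (hf : ∀ k, Measurable (f k)) {y : X → Space d} (hy : Measurable y) :
    StronglyMeasurable fun x =>
      (Submodule.span ℝ (Set.range fun k => f k x)).starProjection (y x) := by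
  refine stronglyMeasurable_of_tendsto atTop (f := fun n x => ∑ i ∈ Finset.range n,
    (Submodule.span ℝ {InnerProductSpace.gramSchmidt ℝ (fun k => f k x) i}).starProjection (y x))
    (fun n => ?_) (tendsto_pi_nhds.2 fun x => tendsto_sum_starProjection_gramSchmidt _ _)
  refine Measurable.stronglyMeasurable (Finset.measurable_fun_sum _ fun i _ => ?_)
  have hi := measurable_gramSchmidt hf i
  simp_rw [Submodule.starProjection_singleton]
  exact ((hi.inner hy).div (hi.norm.pow_const 2)).smul hi

/-! ## Tangent vector fields -/

section Tangent

variable {η : Measure (Space d)}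

theorem abs_le_iSup_of_isTestFun {φ : Space d → ℝ} (hφ : IsTestFun φ) (x : Space d) :
    |φ x| ≤ ⨆ x, |φ x| := by
  obtain ⟨C, hC⟩ := hφ.exists_abs_le
  exact le_ciSup (f := fun x => |φ x|) ⟨C, by rintro _ ⟨y, rfl⟩; exact hC y⟩ x

theorem iSup_abs_nonneg (φ : Space d → ℝ) : 0 ≤ ⨆ x, |φ x| :=
  Real.iSup_nonneg fun _ => abs_nonneg _

theorem integrable_inner_of_memLp {f g : Space d → Space d} (hf : MemLp f 2 η) (hg : MemLp g 2 η) :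
    Integrable (fun x => ⟪f x, g x⟫_ℝ) η := by
  refine (hf.norm.integrable_mul hg.norm).mono'
    (hf.aestronglyMeasurable.inner hg.aestronglyMeasurable) (ae_of_all _ fun x => ?_)
  exact norm_inner_le_norm _ _

theorem IsTestFun.memLp_gradient [IsFiniteMeasure η] {φ : Space d → ℝ} (hφ : IsTestFun φ) :
    MemLp (gradient φ) 2 η := by
  obtain ⟨C, hC⟩ := hφ.exists_norm_gradient_le
  exact MemLp.of_bound hφ.continuous_gradient.aestronglyMeasurable C (ae_of_all _ hC)

theorem integrable_inner_gradient [IsFiniteMeasure η] {φ : Space d → ℝ} (hφ : IsTestFun φ) {ψ : Space d → Space d}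
    (hψ : MemLp ψ 2 η) : Integrable (fun x => ⟪gradient φ x, ψ x⟫_ℝ) η :=
  integrable_inner_of_memLp hφ.memLp_gradient hψ

theorem IsTangentVectorField.congr {ψ ψ' : Space d → Space d} (h : IsTangentVectorField η ψ)
    (h' : ψ =ᵐ[η] ψ') : IsTangentVectorField η ψ' := by
  refine ⟨h.1.ae_eq h', ?_⟩
  obtain ⟨K, hK⟩ := h.2
  refine ⟨K, fun φ hφ => (le_of_eq ?_).trans (hK φ hφ)⟩
  refine integral_congr_ae ?_
  filter_upwards [h'] with x hx
  rw [hx]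

theorem isTangentVectorField_zero : IsTangentVectorField η 0 :=
  ⟨MemLp.zero, 0, fun φ _ => by simp⟩

variable [IsFiniteMeasure η]

theorem IsTangentVectorField.add {ψ ψ' : Space d → Space d} (h : IsTangentVectorField η ψ)
    (h' : IsTangentVectorField η ψ') : IsTangentVectorField η (ψ + ψ') := by
  obtain ⟨K, hK⟩ := h.2
  obtain ⟨K', hK'⟩ := h'.2
  refine ⟨h.1.add h'.1, K + K', fun φ hφ => ?_⟩
  simp only [Pi.add_apply, inner_add_right]
  rw [integral_add (integrable_inner_gradient hφ h.1) (integrable_inner_gradient hφ h'.1), add_mul]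
  exact add_le_add (hK φ hφ) (hK' φ hφ)

theorem IsTestFun.neg {φ : Space d → ℝ} (hφ : IsTestFun φ) : IsTestFun fun x => -φ x :=
  ⟨hφ.1.neg, hφ.2.neg⟩

theorem gradient_fun_neg (φ : Space d → ℝ) (x : Space d) :
    gradient (fun y => -φ y) x = -gradient φ x := by
  simp only [gradient, fderiv_fun_neg, map_neg]

omit [IsFiniteMeasure η] in
theorem IsTangentVectorField.exists_abs_le {ψ : Space d → Space d}
    (h : IsTangentVectorField η ψ) : ∃ K, 0 ≤ K ∧ ∀ φ : Space d → ℝ, IsTestFun φ →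
      |∫ x, ⟪gradient φ x, ψ x⟫_ℝ ∂η| ≤ K * ⨆ x, |φ x| := by
  obtain ⟨K, hK⟩ := h.2
  refine ⟨max K 0, le_max_right _ _, fun φ hφ => abs_le'.2 ⟨?_, ?_⟩⟩
  · exact (hK φ hφ).trans (mul_le_mul_of_nonneg_right (le_max_left _ _) (iSup_abs_nonneg _))
  · have := hK _ hφ.neg
    simp only [gradient_fun_neg, inner_neg_left, abs_neg] at this
    rw [integral_neg] at this
    exact this.trans (mul_le_mul_of_nonneg_right (le_max_left _ _) (iSup_abs_nonneg _))

omit [IsFiniteMeasure η] in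
theorem IsTangentVectorField.const_smul {ψ : Space d → Space d} (h : IsTangentVectorField η ψ)
    (c : ℝ) : IsTangentVectorField η (c • ψ) := by
  obtain ⟨K, hK0, hK⟩ := h.exists_abs_le
  refine ⟨h.1.const_smul c, |c| * K, fun φ hφ => ?_⟩
  simp only [Pi.smul_apply, inner_smul_right]
  rw [integral_const_mul, mul_assoc]
  refine (le_abs_self _).trans ?_
  rw [abs_mul]
  exact mul_le_mul_of_nonneg_left (hK φ hφ) (abs_nonneg c)

theorem IsTangentVectorField.finsetSum {ι : Type*} (s : Finset ι) {ψ : ι → Space d → Space d}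
    (h : ∀ i ∈ s, IsTangentVectorField η (ψ i)) : IsTangentVectorField η (∑ i ∈ s, ψ i) :=
  Finset.sum_induction _ _ (fun _ _ => IsTangentVectorField.add) isTangentVectorField_zero h

/-- Leibniz rule: Dφ·θψ = D(θφ)·ψ - φ Dθ·ψ, and Dθ·ψ is integrable. This stability is what localizes
integral identities over X_η to pointwise ones. -/
theorem IsTangentVectorField.testFun_smul {ψ : Space d → Space d} (h : IsTangentVectorField η ψ)
    {θ : Space d → ℝ} (hθ : IsTestFun θ) : IsTangentVectorField η fun x => θ x • ψ x := by
  obtain ⟨K, hK0, hK⟩ := h.exists_abs_le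
  obtain ⟨C, hC⟩ := hθ.exists_abs_le
  have hC0 : 0 ≤ C := (abs_nonneg _).trans (hC 0)
  have hint := integrable_inner_gradient hθ h.1
  refine ⟨?_, K * C + ∫ x, ‖⟪gradient θ x, ψ x⟫_ℝ‖ ∂η, fun φ hφ => ?_⟩
  · refine MemLp.of_le_mul (c := C) h.1
      (hθ.1.continuous.aestronglyMeasurable.smul h.1.aestronglyMeasurable)
      (ae_of_all _ fun x => ?_)
    rw [norm_smul]
    exact mul_le_mul_of_nonneg_right (hC x) (norm_nonneg _)
  have hpt : ∀ x, ⟪gradient φ x, θ x • ψ x⟫_ℝ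
      = ⟪gradient (fun y => θ y * φ y) x, ψ x⟫_ℝ - φ x * ⟪gradient θ x, ψ x⟫_ℝ := by
    intro x
    rw [gradient_mul (hθ.differentiableAt x) (hφ.differentiableAt x), inner_add_left,
      inner_smul_left, inner_smul_left, inner_smul_right]
    simp
  simp_rw [hpt]
  have hint2 : Integrable (fun x => φ x * ⟪gradient θ x, ψ x⟫_ℝ) η := by
    obtain ⟨D, hD⟩ := hφ.exists_abs_le
    exact hint.bdd_mul hφ.1.continuous.aestronglyMeasurable (ae_of_all _ hD)
  rw [integral_sub (integrable_inner_gradient (hθ.mul hφ) h.1) hint2, add_mul, sub_eq_add_neg]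
  refine add_le_add ?_ ?_
  · refine (le_abs_self _).trans ((hK _ (hθ.mul hφ)).trans ?_)
    rw [mul_assoc]
    refine mul_le_mul_of_nonneg_left (Real.iSup_le (fun x => ?_)
      (mul_nonneg hC0 (iSup_abs_nonneg _))) hK0
    rw [abs_mul]
    exact mul_le_mul (hC x) (abs_le_iSup_of_isTestFun hφ x) (abs_nonneg _) hC0
  · refine (neg_le_abs _).trans ?_
    rw [← integral_mul_const, ← Real.norm_eq_abs]
    refine norm_integral_le_of_norm_le (hint.norm.mul_const _) (ae_of_all _ fun x => ?_)
    rw [norm_mul, mul_comm]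
    exact mul_le_mul_of_nonneg_left (abs_le_iSup_of_isTestFun hφ x) (norm_nonneg _)

/-! ## Existence and uniqueness of the tangent space -/

/-- X_η is a subset of the separable space L²_η, and L² convergence gives a.e. convergence along a
subsequence. -/
theorem exists_dense_seq_tangentVectorField (η : Measure (Space d)) [IsFiniteMeasure η] :
    ∃ f : ℕ → Space d → Space d, (∀ k, Measurable (f k)) ∧
      (∀ k, IsTangentVectorField η (f k)) ∧
      ∀ ψ, IsTangentVectorField η ψ → ∃ ns : ℕ → ℕ,
        ∀ᵐ x ∂η, Tendsto (fun i => f (ns i) x) atTop (𝓝 (ψ x)) := by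
  have : Fact ((2 : ℝ≥0∞) ≠ ⊤) := ⟨by simp⟩
  let S : Set (Lp (Space d) 2 η) := {f | IsTangentVectorField η f}
  have h0 : (0 : Lp (Space d) 2 η) ∈ S :=
    isTangentVectorField_zero.congr (Lp.coeFn_zero _ _ _).symm
  have : Nonempty S := ⟨⟨0, h0⟩⟩
  refine ⟨fun k => (TopologicalSpace.denseSeq S k : Lp (Space d) 2 η),
    fun k => (Lp.stronglyMeasurable _).measurable, fun k => (TopologicalSpace.denseSeq S k).2,
    fun ψ hψ => ?_⟩
  let F : S := ⟨hψ.1.toLp ψ, hψ.congr hψ.1.coeFn_toLp.symm⟩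
  obtain ⟨b, hb, hbF⟩ := mem_closure_iff_seq_limit.1 (TopologicalSpace.denseRange_denseSeq S F)
  choose m hm using hb
  have h1 : Tendsto (fun i => ((TopologicalSpace.denseSeq S (m i) : S) : Lp (Space d) 2 η)) atTop
      (𝓝 (F : Lp (Space d) 2 η)) := by
    simp_rw [hm]
    exact (continuous_subtype_val.tendsto F).comp hbF
  obtain ⟨ns, -, hns⟩ := (tendstoInMeasure_of_tendsto_Lp h1).exists_seq_tendsto_ae
  refine ⟨fun i => m (ns i), ?_⟩
  filter_upwards [hns, hψ.1.coeFn_toLp] with x hx hx'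
  rwa [← hx']

/-- Rational combinations are dense in the span. There are only countably many, so conditions that
hold a.e. for each of them hold a.e. for all at once. -/
theorem mem_of_forall_rat_combination {F : Set (Space d)} (hF : IsClosed F) {f : ℕ → Space d}
    (h : ∀ c : ℕ →₀ ℚ, ∑ i ∈ c.support, (c i : ℝ) • f i ∈ F) {y : Space d}
    (hy : y ∈ Submodule.span ℝ (Set.range f)) : y ∈ F := by
  obtain ⟨c, rfl⟩ := Finsupp.mem_span_range_iff_exists_finsupp.1 hy
  let s := c.support
  let G : (s → ℝ) → Space d := fun a => ∑ i, a i • f i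
  have hG : Continuous G := by fun_prop
  have hd : DenseRange fun q : s → ℚ => fun i => (q i : ℝ) :=
    DenseRange.piMap fun _ => Rat.denseRange_cast
  have h1 : ∀ a, G a ∈ F := by
    intro a
    refine hd.induction_on (p := fun a => G a ∈ F) a (hF.preimage hG) fun q => ?_
    classical
    let q' : ℕ →₀ ℚ := Finsupp.onFinset s (fun i => if hi : i ∈ s then q ⟨i, hi⟩ else 0)
      (fun i hi => by by_contra hi'; simp [hi'] at hi)
    have := h q'
    rw [Finset.sum_subset (Finsupp.support_onFinset_subset : q'.support ⊆ s)
      (fun i _ hi => by rw [Finsupp.notMem_support_iff.1 hi]; simp), ← Finset.sum_coe_sort s] at this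
    convert this using 1
    refine Finset.sum_congr rfl fun i _ => ?_
    simp [q']
  have h2 := h1 fun i => c i
  rw [Finsupp.sum, ← Finset.sum_coe_sort]
  exact h2

/-- The pointwise span of a dense sequence of X_η works. It is closed, hence contains all a.e.
limits; and rational combinations of the sequence stay in X_η, which gives minimality. -/
theorem exists_isTangentSpace (η : Measure (Space d)) [IsFiniteMeasure η] :
    ∃ T : Space d → Submodule ℝ (Space d), IsTangentSpace η T ∧
      ∀ y : Space d → Space d, Measurable y →
        StronglyMeasurable fun x => (T x).starProjection (y x) := by
  obtain ⟨f, hfm, hft, hfd⟩ := exists_dense_seq_tangentVectorField η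
  refine ⟨fun x => Submodule.span ℝ (Set.range fun k => f k x), ⟨fun ψ hψ => ?_, fun F hF h => ?_⟩,
    fun y hy => stronglyMeasurable_starProjection_span hfm hy⟩
  · obtain ⟨ns, hns⟩ := hfd ψ hψ
    filter_upwards [hns] with x hx
    exact (Submodule.closed_of_finiteDimensional _).mem_of_tendsto hx
      (Eventually.of_forall fun i => Submodule.subset_span ⟨ns i, rfl⟩)
  · have h1 : ∀ᵐ x ∂η, ∀ c : ℕ →₀ ℚ, ∑ i ∈ c.support, (c i : ℝ) • f i x ∈ F x := by
      rw [ae_all_iff]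
      intro c
      have := h _ (IsTangentVectorField.finsetSum c.support fun i _ => (hft i).const_smul (c i : ℝ))
      filter_upwards [this] with x hx
      simpa using hx
    filter_upwards [h1] with x hx y hy
    exact mem_of_forall_rat_combination (hF x) hx hy

omit [IsFiniteMeasure η] in
theorem IsTangentSpace.ae_eq {T T' : Space d → Submodule ℝ (Space d)} (hT : IsTangentSpace η T)
    (hT' : IsTangentSpace η T') : T =ᵐ[η] T' := by
  filter_upwards [hT.minimal (fun x => T' x) (fun x => (T' x).closed_of_finiteDimensional)
    fun ψ hψ => hT'.mem ψ hψ, hT'.minimal (fun x => T x)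
    (fun x => (T x).closed_of_finiteDimensional) fun ψ hψ => hT.mem ψ hψ] with x h1 h2
  exact le_antisymm h1 h2

theorem IsTangentSpace.aestronglyMeasurable_starProjection {T : Space d → Submodule ℝ (Space d)}
    (hT : IsTangentSpace η T) {y : Space d → Space d} (hy : AEStronglyMeasurable y η) :
    AEStronglyMeasurable (fun x => (T x).starProjection (y x)) η := by
  obtain ⟨T₀, hT₀, hm⟩ := exists_isTangentSpace η
  refine ⟨_, hm _ hy.stronglyMeasurable_mk.measurable, ?_⟩
  filter_upwards [hT.ae_eq hT₀, hy.ae_eq_mk] with x h1 h2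
  rw [h1, h2]

theorem IsTangentSpace.memLp_starProjection {T : Space d → Submodule ℝ (Space d)}
    (hT : IsTangentSpace η T) {y : Space d → Space d} (hy : MemLp y 2 η) :
    MemLp (fun x => (T x).starProjection (y x)) 2 η :=
  hy.of_le (hT.aestronglyMeasurable_starProjection hy.aestronglyMeasurable)
    (ae_of_all _ fun _ => Submodule.norm_starProjection_apply_le _ _)

end Tangent

/-! ## Tangential gradients -/

section TangentialGradient

variable {η : Measure (Space d)} [IsFiniteMeasure η]

theorem inner_starProjection_of_mem {T : Submodule ℝ (Space d)} {y z : Space d} (hz : z ∈ T) :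
    ⟪T.starProjection y, z⟫_ℝ = ⟪y, z⟫_ℝ := by
  rw [Submodule.inner_starProjection_left_eq_right, Submodule.starProjection_eq_self_iff.2 hz]

omit [IsFiniteMeasure η] in
theorem IsTangentSpace.integral_inner_starProjection {T : Space d → Submodule ℝ (Space d)}
    (hT : IsTangentSpace η T) {ψ : Space d → Space d} (hψ : IsTangentVectorField η ψ)
    (y : Space d → Space d) :
    ∫ x, ⟪(T x).starProjection (y x), ψ x⟫_ℝ ∂η = ∫ x, ⟪y x, ψ x⟫_ℝ ∂η := by
  refine integral_congr_ae ?_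
  filter_upwards [hT.mem ψ hψ] with x hx
  exact inner_starProjection_of_mem hx

/-- The tangent space is weakly closed: weak limits of tangential gradients are tangential. -/
theorem mem_tangentSpace_of_tendsto {T : Space d → Submodule ℝ (Space d)}
    (hT : IsTangentSpace η T) {w : Space d → Space d} (hw : MemLp w 2 η)
    {y : ℕ → Space d → Space d}
    (h : ∀ ψ : Space d → Space d, MemLp ψ 2 η →
      Tendsto (fun n => ∫ x, ⟪(T x).starProjection (y n x), ψ x⟫_ℝ ∂η) atTop
        (𝓝 (∫ x, ⟪w x, ψ x⟫_ℝ ∂η))) :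
    ∀ᵐ x ∂η, w x ∈ T x := by
  -- The normal component w - Pw is the test field: it annihilates every projected gradient, and in
  -- the limit its own square integral is 0.
  have hψ : MemLp (fun x => w x - (T x).starProjection (w x)) 2 η :=
    hw.sub (hT.memLp_starProjection hw)
  have h1 := h _ hψ
  have h2 : ∀ n, ∫ x, ⟪(T x).starProjection (y n x), w x - (T x).starProjection (w x)⟫_ℝ ∂η = 0 := by
    intro n
    refine integral_eq_zero_of_ae (ae_of_all _ fun x => ?_)
    exact Submodule.inner_right_of_mem_orthogonal (Submodule.starProjection_apply_mem _ _)
      (Submodule.sub_starProjection_mem_orthogonal _)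
  simp_rw [h2] at h1
  have h3 : ∫ x, ‖w x - (T x).starProjection (w x)‖ ^ 2 ∂η = 0 := by
    rw [← tendsto_nhds_unique h1 tendsto_const_nhds]
    refine integral_congr_ae (ae_of_all _ fun x => ?_)
    dsimp only
    rw [← real_inner_self_eq_norm_sq, inner_sub_left, Submodule.inner_right_of_mem_orthogonal
      (Submodule.starProjection_apply_mem (T x) (w x))
      (Submodule.sub_starProjection_mem_orthogonal _), sub_zero]
  have h4 := (integral_eq_zero_iff_of_nonneg (fun x => by positivity) hψ.integrable_norm_pow').1 h3
  filter_upwards [h4] with x hx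
  have h5 : w x - (T x).starProjection (w x) = 0 := by simpa using hx
  exact Submodule.starProjection_eq_self_iff.1 (sub_eq_zero.1 h5).symm

omit [IsFiniteMeasure η] in
/-- The action of a tangent field on gradients only depends on the values of the potentials on a
compact set that carries the measure. -/
theorem tendsto_integral_inner_gradient_zero {S : Set (Space d)} (hS : IsCompact S)
    (hη : ∀ᵐ x ∂η, x ∈ S) {f : Space d → ℝ} (hf : Continuous f) (hfS : ∀ x ∈ S, f x = 0)
    {fn : ℕ → Space d → ℝ} (hfn : ∀ n, IsTestFun (fn n)) (hlim : TendstoUniformly fn f atTop)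
    {ψ : Space d → Space d} (hψ : IsTangentVectorField η ψ) :
    Tendsto (fun n => ∫ x, ⟪gradient (fn n) x, ψ x⟫_ℝ ∂η) atTop (𝓝 0) := by
  obtain ⟨K, hK0, hK⟩ := hψ.exists_abs_le
  rw [Metric.tendsto_atTop']
  intro ε hε
  -- On {|f| < δ}, where the cutoff lives, |f_n| ≤ |f_n - f| + |f| ≤ 2δ. The K + 1 in the witness
  -- allows K = 0.
  obtain ⟨δ, hδ, hδε⟩ : ∃ δ > 0, K * (2 * δ) < ε := by
    refine ⟨ε / (2 * (K + 1)), by positivity, ?_⟩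
    have : K * (2 * (ε / (2 * (K + 1)))) = ε * (K / (K + 1)) := by field_simp
    rw [this]
    refine mul_lt_of_lt_one_right hε ((div_lt_one (by positivity)).2 (lt_add_one K))
  obtain ⟨χ, hχ, hχ1, hχ0, hχ01⟩ := exists_cutoff hS
    (isOpen_lt hf.abs continuous_const : IsOpen {x | |f x| < δ})
    (fun x hx => by simpa [hfS x hx] using hδ)
  obtain ⟨N, hN⟩ := eventually_atTop.1 (Metric.tendstoUniformly_iff.1 hlim δ hδ)
  refine ⟨N, fun n hn => ?_⟩
  rw [dist_zero_right]
  have h1 : ∫ x, ⟪gradient (fn n) x, ψ x⟫_ℝ ∂η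
      = ∫ x, ⟪gradient (fun y => χ y * fn n y) x, ψ x⟫_ℝ ∂η := by
    refine integral_congr_ae ?_
    filter_upwards [hη] with x hx
    rw [gradient_mul_of_eventually_one (hχ1.filter_mono (nhds_le_nhdsSet hx))]
  rw [h1]
  refine lt_of_le_of_lt ((hK _ (hχ.mul (hfn n))).trans ?_) hδε
  refine mul_le_mul_of_nonneg_left (Real.iSup_le (fun x => ?_) (by positivity)) hK0
  by_cases hx : |f x| < δ
  · have h2 := hN n hn.le x
    rw [dist_comm, Real.dist_eq] at h2
    rw [abs_mul, abs_of_nonneg (hχ01 x).1]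
    have h3 : |fn n x| ≤ 2 * δ := by
      calc |fn n x| = |(fn n x - f x) + f x| := by rw [sub_add_cancel]
        _ ≤ |fn n x - f x| + |f x| := abs_add_le _ _
        _ ≤ 2 * δ := by linarith
    calc χ x * |fn n x| ≤ 1 * (2 * δ) := by
          gcongr
          exact (hχ01 x).2
      _ = 2 * δ := one_mul _
  · rw [hχ0 x hx, zero_mul, abs_zero]
    positivity

/-- The difference w - w' has zero integral against every ψ in X_η, hence against θψ for test
functions θ, hence is pointwise orthogonal to ψ. By minimality T lies in the orthogonal complement
of w - w', while w - w' itself takes values in T. -/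
theorem HasTangentialGradient.ae_eq {S : Set (Space d)} (hS : IsCompact S)
    (hη : ∀ᵐ x ∂η, x ∈ S) {v v' : Space d → ℝ} (hv : Continuous v) (hv' : Continuous v')
    (hvv' : Set.EqOn v v' S) {w w' : Space d → Space d} (h : HasTangentialGradient η v w)
    (h' : HasTangentialGradient η v' w') : w =ᵐ[η] w' := by
  obtain ⟨hw, T, hT, vn, hvn, hlim, hweak⟩ := h
  obtain ⟨hw', T', hT', vn', hvn', hlim', hweak'⟩ := h'
  have h1 : ∀ ψ, IsTangentVectorField η ψ → ∫ x, ⟪w x - w' x, ψ x⟫_ℝ ∂η = 0 := by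
    intro ψ hψ
    have e1 := hweak ψ hψ.1
    have e2 := hweak' ψ hψ.1
    simp_rw [hT.integral_inner_starProjection hψ] at e1
    simp_rw [hT'.integral_inner_starProjection hψ] at e2
    have e3 := tendsto_integral_inner_gradient_zero hS hη (hv.sub hv')
      (fun x hx => sub_eq_zero.2 (hvv' hx)) (fn := fun n x => vn n x - vn' n x)
      (fun n => ⟨(hvn n).1.sub (hvn' n).1, (hvn n).2.sub (hvn' n).2⟩)
      (hlim.fun_sub hlim') hψ
    have e4 : ∀ n, ∫ x, ⟪gradient (fun x => vn n x - vn' n x) x, ψ x⟫_ℝ ∂η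
        = ∫ x, ⟪gradient (vn n) x, ψ x⟫_ℝ ∂η - ∫ x, ⟪gradient (vn' n) x, ψ x⟫_ℝ ∂η := by
      intro n
      rw [← integral_sub (integrable_inner_gradient (hvn n) hψ.1)
        (integrable_inner_gradient (hvn' n) hψ.1)]
      refine integral_congr_ae (ae_of_all _ fun x => ?_)
      simp only [gradient]
      rw [fderiv_fun_sub ((hvn n).differentiableAt x) ((hvn' n).differentiableAt x), map_sub,
        inner_sub_left]
    simp_rw [e4] at e3
    have e5 := tendsto_nhds_unique (e1.sub e2) e3
    rw [← e5, ← integral_sub (integrable_inner_of_memLp hw hψ.1)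
      (integrable_inner_of_memLp hw' hψ.1)]
    simp_rw [inner_sub_left]
  have h2 : ∀ ψ, IsTangentVectorField η ψ → ∀ᵐ x ∂η, ⟪w x - w' x, ψ x⟫_ℝ = 0 := by
    intro ψ hψ
    have hi : Integrable (fun x => ⟪w x - w' x, ψ x⟫_ℝ) η :=
      integrable_inner_of_memLp (hw.sub hw') hψ.1
    refine ae_eq_zero_of_integral_contDiff_smul_eq_zero hi.locallyIntegrable fun θ hθ hθc => ?_
    rw [← h1 _ (hψ.testFun_smul ⟨hθ, hθc⟩)]
    simp_rw [inner_smul_right, smul_eq_mul]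
  have h3 := hT.minimal (fun x => {z | ⟪w x - w' x, z⟫_ℝ = 0})
    (fun x => isClosed_eq (by fun_prop) continuous_const) h2
  filter_upwards [h3, mem_tangentSpace_of_tendsto hT hw hweak,
    mem_tangentSpace_of_tendsto hT' hw' hweak', hT.ae_eq hT'] with x h3 h4 h5 h6
  have h7 : ⟪w x - w' x, w x - w' x⟫_ℝ = 0 := h3 (Submodule.sub_mem _ h4 (h6 ▸ h5))
  exact sub_eq_zero.1 (inner_self_eq_zero.1 h7)

theorem HasTangentialGradientOn.ae_eq {Ω : Set (Space d)} (hΩb : Bornology.IsBounded Ω)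
    (hη : ∀ᵐ x ∂η, x ∈ closure Ω) {u : Space d → ℝ} {w w' : Space d → Space d}
    (h : HasTangentialGradientOn Ω η u w) (h' : HasTangentialGradientOn Ω η u w') :
    w =ᵐ[η] w' := by
  obtain ⟨v, hv, -, hvu, h⟩ := h
  obtain ⟨v', hv', -, hvu', h'⟩ := h'
  exact h.ae_eq hΩb.isCompact_closure hη hv hv' (fun x hx => (hvu hx).trans (hvu' hx).symm) h'

end TangentialGradient

/-! ## Optimal currents and tangential gradients -/

section Current

variable {μ : Measure (Space d)} [IsFiniteMeasure μ] {ξ : Space d → Space d}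

theorem integral_gradient_withDensityᵥ (hξ : Integrable ξ μ) {φ : Space d → ℝ}
    (hφ : IsTestFun φ) :
    ∫ᵛ x, gradient φ x ∂[innerSL ℝ; μ.withDensityᵥ ξ] = ∫ x, ⟪gradient φ x, ξ x⟫_ℝ ∂μ := by
  obtain ⟨C, hC⟩ := hφ.exists_norm_gradient_le
  rw [integral_vectorMeasure_withDensityᵥ μ hξ (innerSL ℝ)
    hφ.continuous_gradient.stronglyMeasurable hC]
  rfl

/-- A square integrable density of a solution of the divergence equation is tangential. -/
theorem isTangentVectorField_of_isDivSolution (hξ : MemLp ξ 2 μ) {ρ ν : SignedMeasure (Space d)}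
    (h : IsDivSolution (μ.withDensityᵥ ξ) ρ ν) : IsTangentVectorField μ ξ := by
  refine ⟨hξ, (ρ - ν).variation.real Set.univ, fun φ hφ => ?_⟩
  rw [← integral_gradient_withDensityᵥ (hξ.integrable (by norm_num)) hφ, h φ hφ]
  refine (Real.le_norm_self _).trans ((VectorMeasure.norm_integral_le_of_norm_le_const
    (ae_of_all _ fun x => abs_le_iSup_of_isTestFun hφ x)).trans ?_)
  rw [mul_comm]
  refine mul_le_mul_of_nonneg_left ?_ measureReal_nonneg
  exact mul_le_of_le_one_right (iSup_abs_nonneg _) (ContinuousLinearMap.opNorm_lsmul_le)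

theorem memLp_of_norm_eq_one {μ : Measure (Space d)} [IsFiniteMeasure μ] {ξ : Space d → Space d}
    (hξm : AEStronglyMeasurable ξ μ) (h1 : ∀ᵐ x ∂μ, ‖ξ x‖ = 1) : MemLp ξ 2 μ :=
  MemLp.of_bound hξm 1 (h1.mono fun _ h => h.le)

variable {Ω : Set (Space d)} (hΩb : Bornology.IsBounded Ω)
  {ρ ν : SignedMeasure (Space d)} (hρν : CarriedBy (ρ - ν) (closure Ω))

include hρν in
/-- The energy identity for the tangential gradient of a potential. -/
theorem integral_potential_of_hasTangentialGradientOn {u : Space d → ℝ}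
    (hu : HasTangentialGradientOn Ω μ u ξ) (hdiv : IsDivSolution (μ.withDensityᵥ ξ) ρ ν)
    (h1 : ∀ᵐ x ∂μ, ‖ξ x‖ = 1) :
    ∫ᵛ x, u x ∂•(ρ - ν) = μ.real Set.univ := by
  obtain ⟨v, hv, hvc, hvu, hξ, T, hT, vn, hvn, hlim, hweak⟩ := hu
  have h2 := tendsto_integral_of_tendstoUniformly hρν hv hvc hvu hvn hlim
  -- Weak convergence is tested against ξ itself; ξ is tangential, so the projector drops out.
  have h3 := hweak ξ hξ
  simp_rw [hT.integral_inner_starProjection (isTangentVectorField_of_isDivSolution hξ hdiv)] at h3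
  have h4 : ∀ n, ∫ x, ⟪gradient (vn n) x, ξ x⟫_ℝ ∂μ = ∫ᵛ x, vn n x ∂•(ρ - ν) := fun n => by
    rw [← hdiv _ (hvn n), integral_gradient_withDensityᵥ (hξ.integrable (by norm_num)) (hvn n)]
  simp_rw [h4] at h3
  rw [tendsto_nhds_unique h2 h3]
  have h5 : ∀ᵐ x ∂μ, ⟪ξ x, ξ x⟫_ℝ = 1 := by
    filter_upwards [h1] with x hx
    rw [real_inner_self_eq_norm_sq, hx, one_pow]
  rw [integral_congr_ae h5]
  simp

include hΩb hρν in
/-- If a unit field carries a current without duality gap, then it is the tangential gradient of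
the potential. -/
theorem hasTangentialGradientOn_of_integral_eq {u : Space d → ℝ} (hu : IsLipOne Ω u)
    (hμ : ∀ᵐ x ∂μ, x ∈ closure Ω) (hξm : AEStronglyMeasurable ξ μ)
    (h1 : ∀ᵐ x ∂μ, ‖ξ x‖ = 1) (hdiv : IsDivSolution (μ.withDensityᵥ ξ) ρ ν)
    (heq : ∫ᵛ x, u x ∂•(ρ - ν) = μ.real Set.univ) :
    HasTangentialGradientOn Ω μ u ξ := by
  have hξ := memLp_of_norm_eq_one hξm h1
  obtain ⟨v, hv, hvc, hvu, vn, hvn, hlim, hgr⟩ :=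
    exists_test_approx hΩb.isCompact_closure hu.lipschitzOnWith
  obtain ⟨T, hT, -⟩ := exists_isTangentSpace μ
  refine ⟨v, hv, hvc, hvu, hξ, T, hT, vn, hvn, hlim, fun ψ hψ => ?_⟩
  have hmem := hT.mem ξ (isTangentVectorField_of_isDivSolution hξ hdiv)
  have h2 := tendsto_integral_of_tendstoUniformly hρν hv hvc hvu hvn hlim
  rw [heq] at h2
  have h3 : ∀ n, ∫ᵛ x, vn n x ∂•(ρ - ν) = ∫ x, ⟪gradient (vn n) x, ξ x⟫_ℝ ∂μ := fun n => by
    rw [← hdiv _ (hvn n), integral_gradient_withDensityᵥ (hξ.integrable (by norm_num)) (hvn n)]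
  simp_rw [h3] at h2
  have hD : ∀ n, MemLp (fun x => gradient (vn n) x - ξ x) 2 μ := fun n =>
    (hvn n).memLp_gradient.sub hξ
  -- the gradients converge strongly
  have hL2 : Tendsto (fun n => ∫ x, ‖gradient (vn n) x - ξ x‖ ^ 2 ∂μ) atTop (𝓝 0) := by
    have h4 : Tendsto (fun n => 2 * μ.real Set.univ - 2 * ∫ x, ⟪gradient (vn n) x, ξ x⟫_ℝ ∂μ)
        atTop (𝓝 0) := by
      simpa using (h2.const_mul 2).const_sub (2 * μ.real Set.univ)
    refine squeeze_zero (fun n => integral_nonneg fun x => by positivity) (fun n => ?_) h4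
    have hi := integrable_inner_gradient (hvn n) hξ
    calc ∫ x, ‖gradient (vn n) x - ξ x‖ ^ 2 ∂μ
        ≤ ∫ x, (2 - 2 * ⟪gradient (vn n) x, ξ x⟫_ℝ) ∂μ := by
          refine integral_mono_ae (hD n).integrable_norm_pow'
            ((integrable_const _).sub (hi.const_mul 2)) ?_
          filter_upwards [hμ, h1] with x hx hx1
          rw [norm_sub_sq_real, hx1]
          -- |Dv_n - ξ|² = |Dv_n|² - 2 Dv_n·ξ + 1 with |Dv_n| ≤ 1 on the closure of Ω. The integral
          -- of the upper bound tends to 0 because ∫ Dv_n·ξ dμ tends to the full mass of μ.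
          nlinarith [hgr n x hx, norm_nonneg (gradient (vn n) x)]
      _ = 2 * μ.real Set.univ - 2 * ∫ x, ⟪gradient (vn n) x, ξ x⟫_ℝ ∂μ := by
          rw [integral_sub (integrable_const _) (hi.const_mul 2), integral_const_mul,
            integral_const, smul_eq_mul, mul_comm]
  have hP : ∀ n, ∫ x, ⟪(T x).starProjection (gradient (vn n) x), ψ x⟫_ℝ ∂μ
      = ∫ x, ⟪ξ x, ψ x⟫_ℝ ∂μ
        + ∫ x, ⟪(T x).starProjection (gradient (vn n) x - ξ x), ψ x⟫_ℝ ∂μ := by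
    intro n
    rw [← integral_add (integrable_inner_of_memLp hξ hψ)
      (integrable_inner_of_memLp (hT.memLp_starProjection (hD n)) hψ)]
    refine integral_congr_ae ?_
    filter_upwards [hmem] with x hx
    rw [map_sub, Submodule.starProjection_eq_self_iff.2 hx, inner_sub_left]
    ring
  simp_rw [hP]
  suffices h : Tendsto (fun n => ∫ x, ⟪(T x).starProjection (gradient (vn n) x - ξ x), ψ x⟫_ℝ ∂μ)
      atTop (𝓝 0) by simpa using h.const_add (∫ x, ⟪ξ x, ψ x⟫_ℝ ∂μ)
  -- Cauchy–Schwarz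
  have hCS : ∀ n, ‖∫ x, ⟪(T x).starProjection (gradient (vn n) x - ξ x), ψ x⟫_ℝ ∂μ‖
      ≤ Real.sqrt (∫ x, ‖gradient (vn n) x - ξ x‖ ^ 2 ∂μ) * Real.sqrt (∫ x, ‖ψ x‖ ^ 2 ∂μ) := by
    intro n
    refine (norm_integral_le_of_norm_le ((hD n).norm.integrable_mul hψ.norm)
      (ae_of_all _ fun x => ?_)).trans ?_
    · exact (norm_inner_le_norm _ _).trans (mul_le_mul_of_nonneg_right
        (Submodule.norm_starProjection_apply_le _ _) (norm_nonneg _))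
    · have := integral_mul_le_Lp_mul_Lq_of_nonneg (μ := μ) Real.HolderConjugate.two_two
        (ae_of_all _ fun x => norm_nonneg (gradient (vn n) x - ξ x))
        (ae_of_all _ fun x => norm_nonneg (ψ x)) (by simpa using (hD n).norm)
        (by simpa using hψ.norm)
      simpa [Real.sqrt_eq_rpow] using this
  refine squeeze_zero_norm hCS ?_
  have h5 := (Real.continuous_sqrt.tendsto _).comp hL2
  simpa using h5.mul_const (Real.sqrt (∫ x, ‖ψ x‖ ^ 2 ∂μ))

end Current

/-! ## Radial currents -/

section Radial

/-- The parametrisation of the segments that issue from `p`. -/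
def radialMap (p : Space d) (z : Space d × ℝ) : Space d := p + z.2 • (z.1 - p)

theorem continuous_radialMap (p : Space d) : Continuous (radialMap p) := by
  unfold radialMap; fun_prop

/-- The direction of `z` seen from `p`. -/
def radialDirection (p z : Space d) : Space d := ‖z - p‖⁻¹ • (z - p)

theorem measurable_radialDirection (p : Space d) : Measurable (radialDirection p) :=
  ((measurable_id.sub_const p).norm.inv).smul (measurable_id.sub_const p)

theorem norm_radialDirection_le (p z : Space d) : ‖radialDirection p z‖ ≤ 1 := by
  rw [radialDirection, norm_smul, norm_inv, norm_norm]
  exact inv_mul_le_one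

/-- All points p + t(x - p) with t > 0 are seen from p in the same direction; for x = p both sides
vanish. -/
theorem norm_smul_radialDirection (p x : Space d) {t : ℝ} (ht : 0 < t) :
    ‖x - p‖ • radialDirection p (radialMap p (x, t)) = x - p := by
  rcases eq_or_ne x p with rfl | hx
  · simp
  have h : ‖x - p‖ ≠ 0 := norm_ne_zero_iff.2 (sub_ne_zero.2 hx)
  simp only [radialDirection, radialMap, add_sub_cancel_left, norm_smul, smul_smul,
    Real.norm_of_nonneg ht.le]
  have h2 : ‖x - p‖ * ((t * ‖x - p‖)⁻¹ * t) = 1 := by field_simp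
  rw [h2, one_smul]

/-- The mass distribution obtained by transporting `lam` to `p` along segments. -/
def radialMeasure (lam : Measure (Space d)) (p : Space d) : Measure (Space d) :=
  ((lam.prod (volume.restrict (Set.Ioo (0 : ℝ) 1))).withDensity fun z => ‖z.1 - p‖ₑ).map
    (radialMap p)

variable {lam : Measure (Space d)}

theorem radialMeasure_univ (p : Space d) :
    radialMeasure lam p Set.univ = ∫⁻ x, ‖x - p‖ₑ ∂lam := by
  rw [radialMeasure, Measure.map_apply (continuous_radialMap p).measurable MeasurableSet.univ,
    Set.preimage_univ, withDensity_apply _ MeasurableSet.univ, Measure.restrict_univ,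
    lintegral_prod _ (by fun_prop)]
  simp

theorem integral_radialMeasure (p : Space d) (f : Space d → ℝ) (hf : Measurable f) :
    ∫ z, f z ∂radialMeasure lam p
      = ∫ z, ‖z.1 - p‖ * f (radialMap p z) ∂lam.prod (volume.restrict (Set.Ioo (0 : ℝ) 1)) := by
  rw [radialMeasure, integral_map (continuous_radialMap p).measurable.aemeasurable
    hf.aestronglyMeasurable, integral_withDensity_eq_integral_toReal_smul (by fun_prop) (by simp)]
  simp

theorem integral_inner_gradient_segment {φ : Space d → ℝ} (hφ : IsTestFun φ) (p x : Space d) :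
    ∫ t in Set.Ioo (0 : ℝ) 1, ⟪gradient φ (radialMap p (x, t)), x - p⟫_ℝ = φ x - φ p := by
  rw [← integral_Ioc_eq_integral_Ioo, ← intervalIntegral.integral_of_le zero_le_one]
  have h : ∀ t : ℝ, HasDerivAt (fun t => φ (radialMap p (x, t)))
      ⟪gradient φ (radialMap p (x, t)), x - p⟫_ℝ t := by
    intro t
    have h1 : HasDerivAt (fun t : ℝ => radialMap p (x, t)) (x - p) t := by
      simpa [radialMap] using ((hasDerivAt_id t).smul_const (x - p)).const_add p
    have h2 := (hφ.differentiableAt (radialMap p (x, t))).hasFDerivAt.comp_hasDerivAt t h1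
    rwa [gradient, InnerProductSpace.toDual_symm_apply]
  rw [intervalIntegral.integral_eq_sub_of_hasDerivAt (fun t _ => h t)]
  · simp [radialMap]
  · refine Continuous.intervalIntegrable ?_ _ _
    have := hφ.continuous_gradient
    have := continuous_radialMap p
    fun_prop

variable [IsFiniteMeasure lam] {Ω : Set (Space d)}

/-- A measure on a bounded convex open set `Ω` is transported to a point of the closure by a current
that is carried by `Ω` and whose mass is at most the cost of the transport. -/
theorem exists_radial_current (hΩo : IsOpen Ω) (hΩb : Bornology.IsBounded Ω)
    (hΩc : Convex ℝ Ω) (hlam : ∀ᵐ x ∂lam, x ∈ Ω) {p : Space d} (hp : p ∈ closure Ω) :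
    ∃ σ : VectorMeasure (Space d) (Space d), IsFiniteMeasure σ.variation ∧ CarriedBy σ Ω ∧
      σ.variation.real Set.univ ≤ ∫ x, ‖x - p‖ ∂lam ∧
      ∀ φ, IsTestFun φ → ∫ᵛ x, gradient φ x ∂[innerSL ℝ; σ]
        = ∫ x, φ x ∂lam - lam.real Set.univ * φ p := by
  set m := radialMeasure lam p with hm
  have hint : Integrable (fun x => ‖x - p‖) lam :=
    integrable_of_continuous_of_ae_mem hΩb.isCompact_closure
      (hlam.mono fun x hx => subset_closure hx) (by fun_prop)
  have hmu : m Set.univ = ENNReal.ofReal (∫ x, ‖x - p‖ ∂lam) := by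
    rw [radialMeasure_univ, ofReal_integral_eq_lintegral_ofReal hint
      (ae_of_all _ fun x => norm_nonneg _)]
    simp
  have hfin : IsFiniteMeasure m := ⟨by rw [hmu]; exact ENNReal.ofReal_lt_top⟩
  have hθ : Integrable (radialDirection p) m :=
    Integrable.of_bound (measurable_radialDirection p).aestronglyMeasurable 1
      (ae_of_all _ (norm_radialDirection_le p))
  -- Only an inequality, since the direction field is 0 at p.
  have hvar : (m.withDensityᵥ (radialDirection p)).variation ≤ m := by
    rw [Measure.variation_withDensityᵥ hθ]
    calc m.withDensity (fun x => ‖radialDirection p x‖ₑ) ≤ m.withDensity 1 := by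
          refine withDensity_mono (ae_of_all _ fun x => ?_)
          rw [Pi.one_apply]
          change ‖radialDirection p x‖ₑ ≤ 1
          rw [← ofReal_norm]
          exact ENNReal.ofReal_le_one.2 (norm_radialDirection_le p x)
      _ = m := withDensity_one
  have hmΩ : m Ωᶜ = 0 := by
    rw [hm, radialMeasure, Measure.map_apply (continuous_radialMap p).measurable
      hΩo.measurableSet.compl]
    refine withDensity_absolutelyContinuous _ _ ?_
    have h1 : ∀ᵐ z ∂lam.prod (volume.restrict (Set.Ioo (0 : ℝ) 1)), z.1 ∈ Ω :=
      Measure.quasiMeasurePreserving_fst.ae hlam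
    have h2 : ∀ᵐ z ∂lam.prod (volume.restrict (Set.Ioo (0 : ℝ) 1)), z.2 ∈ Set.Ioo (0 : ℝ) 1 :=
      Measure.quasiMeasurePreserving_snd.ae (ae_restrict_mem measurableSet_Ioo)
    have h3 : ∀ᵐ z ∂lam.prod (volume.restrict (Set.Ioo (0 : ℝ) 1)), radialMap p z ∈ Ω := by
      filter_upwards [h1, h2] with z hz1 hz2
      -- An open segment from an interior point to a point of the closure of a convex set stays in
      -- the interior; p itself, possibly on the boundary, is excluded by t > 0.
      have h4 := hΩc.openSegment_interior_closure_subset_interior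
        (hΩo.interior_eq.symm ▸ hz1) hp
      rw [hΩo.interior_eq] at h4
      refine h4 ⟨z.2, 1 - z.2, hz2.1, sub_pos.2 hz2.2, by ring, ?_⟩
      simp only [radialMap]
      module
    exact h3
  refine ⟨m.withDensityᵥ (radialDirection p), isFiniteMeasure_of_le m hvar,
    le_antisymm ((hvar _).trans hmΩ.le) (zero_le), ?_, fun φ hφ => ?_⟩
  · refine (ENNReal.toReal_mono (measure_ne_top m _) (hvar Set.univ)).trans ?_
    rw [hmu, ENNReal.toReal_ofReal (integral_nonneg fun x => norm_nonneg _)]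
  obtain ⟨C, hC⟩ := hφ.exists_norm_gradient_le
  have hgrad := hφ.continuous_gradient
  have hrad := continuous_radialMap p
  rw [integral_gradient_withDensityᵥ hθ hφ, integral_radialMeasure p _
    (hgrad.measurable.inner (measurable_radialDirection p))]
  -- The density |x - p| cancels the normalization of the direction, leaving the derivative of φ
  -- along the segment.
  have h4 : ∀ᵐ z ∂lam.prod (volume.restrict (Set.Ioo (0 : ℝ) 1)),
      ‖z.1 - p‖ * ⟪gradient φ (radialMap p z), radialDirection p (radialMap p z)⟫_ℝ
        = ⟪gradient φ (radialMap p z), z.1 - p⟫_ℝ := by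
    filter_upwards [Measure.quasiMeasurePreserving_snd.ae (ae_restrict_mem measurableSet_Ioo)]
      with z hz
    rw [← inner_smul_right, norm_smul_radialDirection p z.1 hz.1]
  rw [integral_congr_ae h4, integral_prod]
  · simp_rw [integral_inner_gradient_segment hφ]
    rw [integral_sub (integrable_of_continuous_of_ae_mem hΩb.isCompact_closure
      (hlam.mono fun x hx => subset_closure hx) hφ.1.continuous) (integrable_const _),
      integral_const, smul_eq_mul]
  · have h5 : Integrable (fun z : Space d × ℝ => C * ‖z.1 - p‖)
        (lam.prod (volume.restrict (Set.Ioo (0 : ℝ) 1))) :=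
      (hint.comp_fst _).const_mul C
    refine h5.mono' (by fun_prop) (ae_of_all _ fun z => ?_)
    exact (norm_inner_le_norm _ _).trans (mul_le_mul_of_nonneg_right (hC _) (norm_nonneg _))

end Radial

/-! ## Flows -/

/-- The measure `ρ` can be transported to the boundary at cost at most `c`: there is a current
carried by `Ω` with divergence `-ρ` up to boundary terms `α` (outgoing, paid for by `g`) and
`β` (incoming). -/
def IsFlow (Ω : Set (Space d)) (g : Space d → ℝ) (ρ : SignedMeasure (Space d)) (c : ℝ) : Prop :=
  ∃ (σ : VectorMeasure (Space d) (Space d)) (α β : Measure (Space d)),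
    IsFiniteMeasure σ.variation ∧ IsFiniteMeasure α ∧ IsFiniteMeasure β ∧ CarriedBy σ Ω ∧
    (∀ᵐ x ∂α, x ∈ frontier Ω) ∧ (∀ᵐ x ∂β, x ∈ frontier Ω) ∧
    (∀ φ, IsTestFun φ → ∫ᵛ x, gradient φ x ∂[innerSL ℝ; σ]
      = ∫ᵛ x, φ x ∂•ρ - ∫ x, φ x ∂α + ∫ x, φ x ∂β) ∧
    σ.variation.real Set.univ + ∫ x, g x ∂α ≤ c

theorem IsTestFun.integrable {φ : Space d → ℝ} (hφ : IsTestFun φ) (μ : Measure (Space d))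
    [IsFiniteMeasure μ] : Integrable φ μ := by
  obtain ⟨C, hC⟩ := hφ.exists_abs_le
  exact Integrable.of_bound hφ.1.continuous.aestronglyMeasurable C (ae_of_all _ hC)

theorem IsTestFun.integrable_gradient {φ : Space d → ℝ} (hφ : IsTestFun φ)
    (μ : Measure (Space d)) [IsFiniteMeasure μ] : Integrable (gradient φ) μ := by
  obtain ⟨C, hC⟩ := hφ.exists_norm_gradient_le
  exact Integrable.of_bound hφ.continuous_gradient.aestronglyMeasurable C (ae_of_all _ hC)

section Flow

variable {Ω : Set (Space d)} {g : Space d → ℝ}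

theorem isFlow_zero : IsFlow Ω g 0 0 := by
  refine ⟨0, 0, 0, ?_, inferInstance, inferInstance, ?_, by simp, by simp, fun φ _ => ?_, ?_⟩
  · rw [VectorMeasure.variation_zero]; infer_instance
  · simp [CarriedBy]
  · simp
  · simp

section

variable (hg0 : ∀ x ∈ frontier Ω, 0 ≤ g x)

include hg0 in
theorem IsFlow.nonneg {ρ : SignedMeasure (Space d)} {c : ℝ} (h : IsFlow Ω g ρ c) : 0 ≤ c := by
  obtain ⟨σ, α, β, -, -, -, -, hα, -, -, hc⟩ := h
  refine le_trans (add_nonneg measureReal_nonneg (integral_nonneg_of_ae ?_)) hc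
  filter_upwards [hα] with x hx using hg0 x hx

theorem IsFlow.smul {ρ : SignedMeasure (Space d)} {c : ℝ} (h : IsFlow Ω g ρ c) {r : ℝ}
    (hr : 0 ≤ r) : IsFlow Ω g (r • ρ) (r * c) := by
  obtain ⟨σ, α, β, hσf, hαf, hβf, hσ, hα, hβ, hdiv, hc⟩ := h
  lift r to NNReal using hr
  have hvar : ((r : ℝ) • σ).variation = r • σ.variation := by
    rw [VectorMeasure.variation_smul, NNReal.nnnorm_eq]
  refine ⟨(r : ℝ) • σ, r • α, r • β, ?_, inferInstance, inferInstance, ?_,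
    Measure.ae_smul_measure hα r, Measure.ae_smul_measure hβ r, fun φ hφ => ?_, ?_⟩
  · rw [hvar]; infer_instance
  · rw [CarriedBy, hvar, Measure.smul_apply, show σ.variation Ωᶜ = 0 from hσ, smul_zero]
  · rw [VectorMeasure.integral_smul_vectorMeasure, VectorMeasure.integral_smul_vectorMeasure,
      hdiv φ hφ, integral_smul_nnreal_measure, integral_smul_nnreal_measure]
    simp only [NNReal.smul_def, smul_eq_mul]
    ring
  · rw [hvar, integral_smul_nnreal_measure, measureReal_nnreal_smul_apply, NNReal.smul_def,
      smul_eq_mul, ← mul_add]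
    exact mul_le_mul_of_nonneg_left hc r.2

variable (hgb : BddAbove (g '' frontier Ω)) (hgl : LowerSemicontinuousOn g (frontier Ω))

include hg0 hgb hgl in
-- The boundary terms α and β are independent nonnegative measures, not Jordan parts, so that the
-- boundary cost is additive.
theorem IsFlow.add {ρ ρ' : SignedMeasure (Space d)} {c c' : ℝ} (h : IsFlow Ω g ρ c)
    (h' : IsFlow Ω g ρ' c') : IsFlow Ω g (ρ + ρ') (c + c') := by
  obtain ⟨σ, α, β, hσf, hαf, hβf, hσ, hα, hβ, hdiv, hc⟩ := h
  obtain ⟨σ', α', β', hσf', hαf', hβf', hσ', hα', hβ', hdiv', hc'⟩ := h'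
  refine ⟨σ + σ', α + α', β + β', ?_, inferInstance, inferInstance, hσ.add hσ',
    ae_add_measure_iff.2 ⟨hα, hα'⟩, ae_add_measure_iff.2 ⟨hβ, hβ'⟩, fun φ hφ => ?_, ?_⟩
  · exact isFiniteMeasure_of_le _ (VectorMeasure.variation_add_le (μ := σ) (ν := σ'))
  · rw [VectorMeasure.integral_add_vectorMeasure (hφ.integrable_gradient _)
      (hφ.integrable_gradient _), VectorMeasure.integral_add_vectorMeasure (hφ.integrable _)
      (hφ.integrable _), hdiv φ hφ, hdiv' φ hφ, integral_add_measure (hφ.integrable _)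
      (hφ.integrable _), integral_add_measure (hφ.integrable _) (hφ.integrable _)]
    ring
  · rw [integral_add_measure (integrable_boundary_cost hg0 hgb hgl hα)
      (integrable_boundary_cost hg0 hgb hgl hα')]
    have h1 : (σ + σ').variation.real Set.univ
        ≤ σ.variation.real Set.univ + σ'.variation.real Set.univ := by
      rw [← measureReal_add_apply]
      exact ENNReal.toReal_mono (measure_ne_top _ _) (VectorMeasure.variation_add_le _)
    linarith

end

section Radial

variable (hΩo : IsOpen Ω) (hΩb : Bornology.IsBounded Ω) (hΩc : Convex ℝ Ω)
  {lam : Measure (Space d)} [IsFiniteMeasure lam] (hlam : ∀ᵐ x ∂lam, x ∈ Ω)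

include hΩo hΩb hΩc hlam

/-- There is no boundary term, so the current can be reversed at the same cost. -/
theorem isFlow_radial {p : Space d} (hp : p ∈ Ω) :
    IsFlow Ω g (lam.toSignedMeasure - lam.real Set.univ • (Measure.dirac p).toSignedMeasure)
      (∫ x, ‖x - p‖ ∂lam) ∧
    IsFlow Ω g (-(lam.toSignedMeasure - lam.real Set.univ • (Measure.dirac p).toSignedMeasure))
      (∫ x, ‖x - p‖ ∂lam) := by
  obtain ⟨σ, hσf, hσ, hcost, hdiv⟩ := exists_radial_current hΩo hΩb hΩc hlam (subset_closure hp)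
  have key : ∀ φ, IsTestFun φ → ∫ᵛ x, φ x ∂•(lam.toSignedMeasure
      - lam.real Set.univ • (Measure.dirac p).toSignedMeasure)
      = ∫ x, φ x ∂lam - lam.real Set.univ * φ p := fun φ hφ => by
    rw [VectorMeasure.integral_sub_vectorMeasure (hφ.integrable _) (hφ.integrable _),
      VectorMeasure.integral_smul_vectorMeasure, integral_toSignedMeasure_smul,
      integral_toSignedMeasure_smul, integral_dirac, smul_eq_mul]
  refine ⟨⟨σ, 0, 0, hσf, inferInstance, inferInstance, hσ, by simp, by simp, fun φ hφ => ?_,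
    by simpa using hcost⟩, ⟨-σ, 0, 0, ?_, inferInstance, inferInstance, hσ.neg, by simp, by simp,
    fun φ hφ => ?_, by simpa using hcost⟩⟩
  · rw [key φ hφ, hdiv φ hφ]; simp
  · rwa [VectorMeasure.variation_neg]
  · rw [VectorMeasure.integral_neg_vectorMeasure, VectorMeasure.integral_neg_vectorMeasure,
      key φ hφ, hdiv φ hφ]
    simp

/-- Mass leaving through p pays g(p), while mass entering is free; the two bounds 0 and g for the
potential come from this asymmetry. -/
theorem isFlow_radial_frontier {p : Space d} (hp : p ∈ frontier Ω) :
    IsFlow Ω g lam.toSignedMeasure (∫ x, ‖x - p‖ ∂lam + lam.real Set.univ * g p) ∧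
    IsFlow Ω g (-lam.toSignedMeasure) (∫ x, ‖x - p‖ ∂lam) := by
  obtain ⟨σ, hσf, hσ, hcost, hdiv⟩ := exists_radial_current hΩo hΩb hΩc hlam
    (frontier_subset_closure hp)
  set γ : Measure (Space d) := (lam Set.univ).toNNReal • Measure.dirac p with hγ
  have hγp : ∀ᵐ x ∂γ, x ∈ frontier Ω :=
    Measure.ae_smul_measure ((ae_dirac_iff isClosed_frontier.measurableSet).2 hp) _
  have hγi : ∀ f : Space d → ℝ, ∫ x, f x ∂γ = lam.real Set.univ * f p := fun f => by
    rw [hγ, integral_smul_nnreal_measure, integral_dirac]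
    rfl
  refine ⟨⟨σ, γ, 0, hσf, inferInstance, inferInstance, hσ, hγp, by simp, fun φ hφ => ?_, ?_⟩,
    ⟨-σ, 0, γ, ?_, inferInstance, inferInstance, hσ.neg, by simp, hγp, fun φ hφ => ?_,
    by simpa using hcost⟩⟩
  · rw [hdiv φ hφ, integral_toSignedMeasure_smul, hγi]; simp
  · rw [hγi]; linarith
  · rwa [VectorMeasure.variation_neg]
  · rw [VectorMeasure.integral_neg_vectorMeasure, VectorMeasure.integral_neg_vectorMeasure,
      hdiv φ hφ, integral_toSignedMeasure_smul, hγi, integral_zero_measure]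
    ring

end Radial

theorem frontier_nonempty_of_isBounded (hd : d ≠ 0) (hΩb : Bornology.IsBounded Ω)
    (hne : Ω.Nonempty) : (frontier Ω).Nonempty := by
  have : Nontrivial (Space d) := by
    have : Nonempty (Fin d) := ⟨⟨0, Nat.pos_of_ne_zero hd⟩⟩
    infer_instance
  refine nonempty_frontier_iff.2 ⟨hne, fun h => ?_⟩
  rw [h] at hΩb
  exact NormedSpace.unbounded_univ ℝ (Space d) hΩb

/-- All of ρ⁺ can leave and all of ρ⁻ enter through one boundary point, so the least cost is finite.
-/
theorem exists_isFlow (hd : d ≠ 0) (hΩo : IsOpen Ω) (hΩb : Bornology.IsBounded Ω)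
    (hΩc : Convex ℝ Ω) (hg0 : ∀ x ∈ frontier Ω, 0 ≤ g x) (hgb : BddAbove (g '' frontier Ω))
    (hgl : LowerSemicontinuousOn g (frontier Ω)) (ρ : SignedMeasure (Space d)) :
    ∃ c, IsFlow Ω g (ρ.restrict Ω) c := by
  rcases Ω.eq_empty_or_nonempty with rfl | hne
  · rw [VectorMeasure.restrict_empty]
    exact ⟨0, isFlow_zero⟩
  obtain ⟨p, hp⟩ := frontier_nonempty_of_isBounded hd hΩb hne
  have h : ρ.restrict Ω = ((posPart ρ).restrict Ω).toSignedMeasure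
      + -((negPart ρ).restrict Ω).toSignedMeasure := by
    conv_lhs => rw [← ρ.toSignedMeasure_toJordanDecomposition]
    rw [JordanDecomposition.toSignedMeasure, VectorMeasure.restrict_sub,
      Measure.toSignedMeasure_restrict_eq_restrict_toSignedMeasure _ _ hΩo.measurableSet,
      Measure.toSignedMeasure_restrict_eq_restrict_toSignedMeasure _ _ hΩo.measurableSet,
      sub_eq_add_neg]
    rfl
  rw [h]
  exact ⟨_, (isFlow_radial_frontier hΩo hΩb hΩc (ae_restrict_mem hΩo.measurableSet) hp).1.add
    hg0 hgb hgl
    (isFlow_radial_frontier hΩo hΩb hΩc (ae_restrict_mem hΩo.measurableSet) hp).2⟩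

/-- With ν = α - β the common part of α and β cancels: ν⁺ ≤ α, and since g ≥ 0 on the boundary the
cost can only drop. -/
theorem IsFlow.exists_current (hg0 : ∀ x ∈ frontier Ω, 0 ≤ g x)
    (hgb : BddAbove (g '' frontier Ω)) (hgl : LowerSemicontinuousOn g (frontier Ω))
    {ρ : SignedMeasure (Space d)} {c : ℝ} (h : IsFlow Ω g ρ c) :
    ∃ σ ν, IsAdmissibleCurrent Ω Ω ρ σ ν ∧ currentCost Ω g σ ν ≤ ENNReal.ofReal c := by
  obtain ⟨σ, α, β, hσf, hαf, hβf, hσ, hα, hβ, hdiv, hc⟩ := h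
  have hν : CarriedBy (α.toSignedMeasure - β.toSignedMeasure) (frontier Ω) := by
    refine CarriedBy.sub ?_ ?_
    · rw [CarriedBy, Measure.variation_toSignedMeasure]; exact hα
    · rw [CarriedBy, Measure.variation_toSignedMeasure]; exact hβ
  refine ⟨σ, α.toSignedMeasure - β.toSignedMeasure, ⟨hσ, hν, fun φ hφ => ?_⟩, ?_⟩
  · rw [hdiv φ hφ, VectorMeasure.integral_sub_vectorMeasure (hφ.integrable _)
      (hφ.integrable _),
      VectorMeasure.integral_sub_vectorMeasure (hφ.integrable _) (hφ.integrable _),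
      integral_toSignedMeasure_smul, integral_toSignedMeasure_smul]
    ring
  · rw [currentCost_eq hg0 hgb hgl hν]
    refine ENNReal.ofReal_le_ofReal (le_trans (add_le_add le_rfl ?_) hc)
    have h1 : posPart (α.toSignedMeasure - β.toSignedMeasure) ≤ α := by
      rw [posPart, Measure.toJordanDecomposition_toSignedMeasure_sub,
        Measure.jordanDecompositionOfToSignedMeasureSub_posPart]
      exact Measure.sub_le
    refine integral_mono_measure h1 ?_ (integrable_boundary_cost hg0 hgb hgl hα)
    filter_upwards [hα] with x hx using hg0 x hx

end Flow

/-! ## Strong duality -/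

/-- Hahn–Banach, extending c x ↦ c N(x) from the line through x. For c < 0 the domination follows
from 0 = N(0) ≤ N(c x) + N(-c x). -/
theorem exists_linear_le_sublinear {E : Type*} [AddCommGroup E] [Module ℝ E] {N : E → ℝ}
    (N_hom : ∀ c : ℝ, 0 < c → ∀ x, N (c • x) = c * N x) (N_add : ∀ x y, N (x + y) ≤ N x + N y)
    (x : E) : ∃ f : E →ₗ[ℝ] ℝ, f x = N x ∧ ∀ y, f y ≤ N y := by
  have N_0 : N 0 = 0 := by
    have := N_hom 2 two_pos 0
    rw [smul_zero] at this
    linarith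
  have h0 : ∀ c : ℝ, c • x = 0 → c • N x = 0 := by
    intro c hc
    rcases eq_or_ne c 0 with rfl | hc0
    · simp
    · rw [(smul_eq_zero_iff_right hc0).1 hc, N_0, smul_zero]
  obtain ⟨f, hf, hfN⟩ := exists_extension_of_le_sublinear
    (LinearPMap.mkSpanSingleton' x (N x) h0) N N_hom N_add (by
      rintro ⟨y, hy⟩
      obtain ⟨c, rfl⟩ := Submodule.mem_span_singleton.1 hy
      rw [LinearPMap.mkSpanSingleton'_apply, smul_eq_mul, RingHom.id_apply]
      change c * N x ≤ N (c • x)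
      rcases lt_trichotomy c 0 with hc | rfl | hc
      · have h1 := N_add (c • x) ((-c) • x)
        rw [← add_smul, add_neg_cancel, zero_smul, N_0, N_hom (-c) (by linarith)] at h1
        linarith
      · simp [N_0]
      · rw [N_hom c hc])
  refine ⟨f, ?_, hfN⟩
  have hx := hf ⟨x, Submodule.mem_span_singleton_self x⟩
  exact hx.trans (LinearPMap.mkSpanSingleton'_apply_self (σ := RingHom.id ℝ) x (N x) h0 _)

/-- Hahn–Banach for the least flow cost, which is sublinear. Restricting measures to Ω makes this
cost finite on the whole space of signed measures; ε appears because the infimum need not be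
attained. -/
theorem exists_linear_le_flow {Ω : Set (Space d)} {g : Space d → ℝ} (hd : d ≠ 0)
    (hΩo : IsOpen Ω) (hΩb : Bornology.IsBounded Ω)
    (hΩc : Convex ℝ Ω) (hg0 : ∀ x ∈ frontier Ω, 0 ≤ g x) (hgb : BddAbove (g '' frontier Ω))
    (hgl : LowerSemicontinuousOn g (frontier Ω)) (ρ : SignedMeasure (Space d)) :
    ∃ f : SignedMeasure (Space d) →ₗ[ℝ] ℝ,
      (∀ ε > 0, IsFlow Ω g (ρ.restrict Ω) (f ρ + ε)) ∧
      ∀ ρ' c, IsFlow Ω g (VectorMeasure.restrict ρ' Ω) c → f ρ' ≤ c := by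
  let S : SignedMeasure (Space d) → Set ℝ := fun ρ => {c | IsFlow Ω g (ρ.restrict Ω) c}
  have hne : ∀ ρ, (S ρ).Nonempty := exists_isFlow hd hΩo hΩb hΩc hg0 hgb hgl
  have hbd : ∀ ρ, BddBelow (S ρ) := fun ρ => ⟨0, fun c hc => hc.nonneg hg0⟩
  have hsmul : ∀ c : ℝ, 0 < c → ∀ ρ, sInf (S (c • ρ)) ≤ c * sInf (S ρ) := by
    intro c hc ρ
    rw [← div_le_iff₀' hc]
    refine le_csInf (hne ρ) fun k hk => ?_
    rw [div_le_iff₀' hc]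
    refine csInf_le (hbd _) ?_
    change IsFlow Ω g (VectorMeasure.restrict (c • ρ) Ω) (c * k)
    rw [VectorMeasure.restrict_smul]
    exact hk.smul hc.le
  obtain ⟨f, hfρ, hf⟩ := exists_linear_le_sublinear (N := fun ρ => sInf (S ρ)) (fun c hc ρ => by
      refine le_antisymm (hsmul c hc ρ) ?_
      have h := hsmul c⁻¹ (inv_pos.2 hc) (c • ρ)
      rw [smul_smul, inv_mul_cancel₀ hc.ne', one_smul] at h
      rwa [← div_eq_inv_mul, le_div_iff₀' hc] at h) (fun ρ ρ' => by
      rw [← sub_le_iff_le_add]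
      refine le_csInf (hne ρ) fun k hk => ?_
      rw [sub_le_comm]
      refine le_csInf (hne ρ') fun k' hk' => ?_
      rw [sub_le_iff_le_add']
      refine csInf_le (hbd _) ?_
      change IsFlow Ω g (VectorMeasure.restrict (ρ + ρ') Ω) (k + k')
      rw [VectorMeasure.restrict_add]
      exact hk.add hg0 hgb hgl hk') ρ
  refine ⟨f, fun ε hε => ?_, fun ρ' c h => (hf ρ').trans (csInf_le (hbd _) h)⟩
  obtain ⟨k, hk, hkε⟩ := exists_lt_of_csInf_lt (hne ρ)
    (show sInf (S ρ) < f ρ + ε by rw [hfρ]; linarith)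
  obtain ⟨σ, α, β, h1, h2, h3, h4, h5, h6, h7, h8⟩ := hk
  exact ⟨σ, α, β, h1, h2, h3, h4, h5, h6, h7, h8.trans hkε.le⟩

/-! ### Representation of the functional by a Lipschitz potential -/

section Potential

variable {Ω : Set (Space d)} {g : Space d → ℝ} (hΩo : IsOpen Ω) (hΩb : Bornology.IsBounded Ω)
  (hΩc : Convex ℝ Ω) {f : SignedMeasure (Space d) →ₗ[ℝ] ℝ}
  (hf : ∀ ρ c, IsFlow Ω g (VectorMeasure.restrict ρ Ω) c → f ρ ≤ c)

theorem restrict_toSignedMeasure_of_ae_mem (hΩm : MeasurableSet Ω) {lam : Measure (Space d)}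
    [IsFiniteMeasure lam] (hlam : ∀ᵐ x ∂lam, x ∈ Ω) :
    lam.toSignedMeasure.restrict Ω = lam.toSignedMeasure := by
  rw [Measure.toSignedMeasure_restrict_eq_restrict_toSignedMeasure _ _ hΩm]
  exact Measure.toSignedMeasure_congr (Measure.restrict_eq_self_of_ae_mem hlam)

/-- The potential of a linear functional on measures. -/
def potential (f : SignedMeasure (Space d) →ₗ[ℝ] ℝ) (x : Space d) : ℝ :=
  f (Measure.dirac x).toSignedMeasure

include hΩo hΩb hΩc hf

/-- The radial flow to p and its reverse bound `f` from both sides. Taking a Dirac mass gives the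
Lipschitz bound; taking a measure of small support gives the representation by an integral. -/
theorem abs_sub_potential_le {lam : Measure (Space d)} [IsFiniteMeasure lam]
    (hlam : ∀ᵐ x ∂lam, x ∈ Ω) {p : Space d} (hp : p ∈ Ω) :
    |f lam.toSignedMeasure - lam.real Set.univ * potential f p| ≤ ∫ x, ‖x - p‖ ∂lam := by
  have hdir : ∀ᵐ x ∂Measure.dirac p, x ∈ Ω := (ae_dirac_iff hΩo.measurableSet).2 hp
  have h := isFlow_radial (g := g) hΩo hΩb hΩc hlam hp
  have e1 : lam.toSignedMeasure - lam.real Set.univ • (Measure.dirac p).toSignedMeasure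
      = VectorMeasure.restrict
        (lam.toSignedMeasure - lam.real Set.univ • (Measure.dirac p).toSignedMeasure) Ω := by
    rw [VectorMeasure.restrict_sub, VectorMeasure.restrict_smul,
      restrict_toSignedMeasure_of_ae_mem hΩo.measurableSet hlam,
      restrict_toSignedMeasure_of_ae_mem hΩo.measurableSet hdir]
  have h1 := hf _ _ (e1 ▸ h.1)
  have h2 := hf (-(lam.toSignedMeasure - lam.real Set.univ • (Measure.dirac p).toSignedMeasure)) _
    (by rw [VectorMeasure.restrict_neg, ← e1]; exact h.2)
  simp only [map_neg, map_sub, map_smul, smul_eq_mul] at h1 h2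
  exact abs_le'.2 ⟨h1, h2⟩

theorem lipschitzOnWith_potential : LipschitzOnWith 1 (potential f) Ω := by
  refine LipschitzOnWith.of_dist_le_mul fun x hx y hy => ?_
  have h := abs_sub_potential_le hΩo hΩb hΩc hf
    ((ae_dirac_iff hΩo.measurableSet).2 hx : ∀ᵐ z ∂Measure.dirac x, z ∈ Ω) hy
  rw [integral_dirac, probReal_univ, one_mul] at h
  rw [NNReal.coe_one, one_mul, Real.dist_eq, dist_eq_norm]
  exact h

theorem potential_bounds {x p : Space d} (hx : x ∈ Ω) (hp : p ∈ frontier Ω) :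
    -‖x - p‖ ≤ potential f x ∧ potential f x ≤ g p + ‖x - p‖ := by
  have hdir : ∀ᵐ z ∂Measure.dirac x, z ∈ Ω := (ae_dirac_iff hΩo.measurableSet).2 hx
  have h := isFlow_radial_frontier (g := g) hΩo hΩb hΩc hdir hp
  have e1 := restrict_toSignedMeasure_of_ae_mem hΩo.measurableSet hdir
  have h1 := hf _ _ (e1.symm ▸ h.1)
  have h2 := hf (-(Measure.dirac x).toSignedMeasure) _
    (by rw [VectorMeasure.restrict_neg, e1]; exact h.2)
  rw [integral_dirac, probReal_univ, one_mul] at h1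
  rw [integral_dirac, map_neg] at h2
  exact ⟨by unfold potential; linarith, by unfold potential; linarith⟩

/-- A Lipschitz extension inherits the boundary bounds by approaching p from x in Ω: the error is |x
- p| from `potential_bounds` plus |x - p| from the Lipschitz estimate. -/
theorem exists_admissible_extension :
    ∃ v, IsAdmissiblePotential Ω g v ∧ LipschitzWith 1 v ∧ Set.EqOn v (potential f) Ω := by
  obtain ⟨v, hv, hfv⟩ := (lipschitzOnWith_potential hΩo hΩb hΩc hf).extend_real
  have hlip : ∀ x y, |v x - v y| ≤ ‖x - y‖ := fun x y => by
    simpa [Real.dist_eq, dist_eq_norm] using hv.dist_le_mul x y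
  refine ⟨v, ⟨⟨⟨1, hv⟩, fun x _ y _ => ?_⟩, fun p hp => ?_⟩, hv, hfv.symm⟩
  · exact (le_abs_self _).trans (norm_sub_rev x y ▸ hlip y x)
  have key : ∀ ε > 0, ∃ x ∈ Ω, ‖x - p‖ < ε := fun ε hε => by
    obtain ⟨x, hx, hxp⟩ := Metric.mem_closure_iff.1 (frontier_subset_closure hp) ε hε
    exact ⟨x, hx, by rwa [← dist_eq_norm, dist_comm]⟩
  constructor
  · refine le_of_forall_pos_le_add fun ε hε => ?_
    obtain ⟨x, hx, hxp⟩ := key (ε / 2) (half_pos hε)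
    have h1 := (potential_bounds hΩo hΩb hΩc hf hx hp).1
    rw [hfv hx] at h1
    linarith [le_abs_self (v x - v p), hlip x p]
  · refine le_of_forall_pos_le_add fun ε hε => ?_
    obtain ⟨x, hx, hxp⟩ := key (ε / 2) (half_pos hε)
    have h1 := (potential_bounds hΩo hΩb hΩc hf hx hp).2
    rw [hfv hx] at h1
    linarith [neg_abs_le (v x - v p), hlip x p]

/-- On a set of small diameter the functional is close to integration of its potential. -/
theorem abs_sub_setIntegral_le_of_diam {v : Space d → ℝ} (hv : LipschitzWith 1 v)
    (hvf : Set.EqOn v (potential f) Ω) {lam : Measure (Space d)} [IsFiniteMeasure lam]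
    {C : Set (Space d)} (hC : MeasurableSet C) (hCΩ : C ⊆ Ω) {r : ℝ}
    (hr : ∀ x ∈ C, ∀ y ∈ C, ‖x - y‖ ≤ r) :
    |f (lam.restrict C).toSignedMeasure - ∫ x in C, v x ∂lam| ≤ 2 * r * lam.real C := by
  rcases C.eq_empty_or_nonempty with rfl | ⟨p, hp⟩
  · have : (lam.restrict ∅).toSignedMeasure = 0 := by
      rw [Measure.toSignedMeasure_congr Measure.restrict_empty, Measure.toSignedMeasure_zero]
    rw [this]
    simp
  have hmem : ∀ᵐ x ∂lam.restrict C, x ∈ C := ae_restrict_mem hC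
  have hint : ∀ {u : Space d → ℝ}, Continuous u → Integrable u (lam.restrict C) := fun hu =>
    integrable_of_continuous_of_ae_mem hΩb.isCompact_closure
      (hmem.mono fun x hx => subset_closure (hCΩ hx)) hu
  have hle : ∫ x in C, ‖x - p‖ ∂lam ≤ r * lam.real C := by
    calc ∫ x in C, ‖x - p‖ ∂lam ≤ ∫ x in C, r ∂lam := by
          refine integral_mono_ae (hint (by fun_prop)) (integrable_const _) ?_
          filter_upwards [hmem] with x hx using hr x hx p hp
      _ = r * lam.real C := by rw [setIntegral_const, smul_eq_mul, mul_comm]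
  have h1 := abs_sub_potential_le hΩo hΩb hΩc hf (hmem.mono fun x hx => hCΩ hx) (hCΩ hp)
  rw [measureReal_restrict_apply_univ, ← hvf (hCΩ hp)] at h1
  have h2 : |lam.real C * v p - ∫ x in C, v x ∂lam| ≤ ∫ x in C, ‖x - p‖ ∂lam := by
    have h3 : lam.real C * v p = ∫ x in C, v p ∂lam := by rw [setIntegral_const, smul_eq_mul]
    rw [h3, ← integral_sub (integrable_const _) (hint hv.continuous), ← Real.norm_eq_abs]
    refine norm_integral_le_of_norm_le (hint (by fun_prop)) (ae_of_all _ fun x => ?_)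
    rw [norm_sub_rev]
    simpa [dist_eq_norm] using hv.dist_le_mul x p
  calc _ = |(f (lam.restrict C).toSignedMeasure - lam.real C * v p)
        + (lam.real C * v p - ∫ x in C, v x ∂lam)| := by rw [sub_add_sub_cancel]
    _ ≤ _ := abs_add_le _ _
    _ ≤ 2 * r * lam.real C := by linarith

/-- Balls are peeled off one at a time. Each piece has diameter at most 2r, whence 4r; errors are
proportional to masses, so the bound does not depend on the number of balls. -/
theorem abs_sub_setIntegral_le_of_cover {v : Space d → ℝ} (hv : LipschitzWith 1 v)
    (hvf : Set.EqOn v (potential f) Ω) {lam : Measure (Space d)} [IsFiniteMeasure lam]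
    {r : ℝ} (t : Finset (Space d)) {B : Set (Space d)} (hB : MeasurableSet B) (hBΩ : B ⊆ Ω)
    (hcov : B ⊆ ⋃ y ∈ t, Metric.ball y r) :
    |f (lam.restrict B).toSignedMeasure - ∫ x in B, v x ∂lam| ≤ 4 * r * lam.real B := by
  classical
  induction t using Finset.induction_on generalizing B with
  | empty =>
    have hB0 : B = ∅ := by simpa using hcov
    subst hB0
    have := abs_sub_setIntegral_le_of_diam hΩo hΩb hΩc hf hv hvf (lam := lam)
      MeasurableSet.empty (Set.empty_subset Ω) (r := 2 * r) (by simp)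
    refine this.trans (le_of_eq (by ring))
  | insert a t _ ih =>
    have hm1 : MeasurableSet (B ∩ Metric.ball a r) := hB.inter measurableSet_ball
    have hm2 : MeasurableSet (B \ Metric.ball a r) := hB.diff measurableSet_ball
    have h1 := abs_sub_setIntegral_le_of_diam hΩo hΩb hΩc hf hv hvf (lam := lam) hm1
      (Set.inter_subset_left.trans hBΩ) (r := 2 * r) (fun x hx y hy => by
        have hx' := Metric.mem_ball.1 hx.2
        have hy' := Metric.mem_ball'.1 hy.2
        rw [← dist_eq_norm]
        linarith [dist_triangle x a y])
    have h2 := ih hm2 (Set.sdiff_subset.trans hBΩ) (fun x hx => by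
      have := hcov hx.1
      rw [Finset.set_biUnion_insert] at this
      exact this.resolve_left hx.2)
    have hdis : Disjoint (B ∩ Metric.ball a r) (B \ Metric.ball a r) :=
      Set.disjoint_sdiff_inter.symm
    have e0 : lam.restrict B
        = lam.restrict (B ∩ Metric.ball a r) + lam.restrict (B \ Metric.ball a r) :=
      (Measure.restrict_inter_add_sdiff B measurableSet_ball).symm
    have e1 : (lam.restrict B).toSignedMeasure
        = (lam.restrict (B ∩ Metric.ball a r)).toSignedMeasure
          + (lam.restrict (B \ Metric.ball a r)).toSignedMeasure := by
      rw [← Measure.toSignedMeasure_add]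
      exact Measure.toSignedMeasure_congr e0
    have hint : IntegrableOn v B lam :=
      integrable_of_continuous_of_ae_mem hΩb.isCompact_closure
        ((ae_restrict_mem hB).mono fun x hx => subset_closure (hBΩ hx)) hv.continuous
    have e2 : ∫ x in B, v x ∂lam = ∫ x in B ∩ Metric.ball a r, v x ∂lam
        + ∫ x in B \ Metric.ball a r, v x ∂lam :=
      (integral_inter_add_sdiff measurableSet_ball hint).symm
    have e3 : lam.real B = lam.real (B ∩ Metric.ball a r) + lam.real (B \ Metric.ball a r) :=
      (measureReal_inter_add_sdiff measurableSet_ball).symm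
    rw [e1, e2, e3, map_add]
    calc _ = |(f (lam.restrict (B ∩ Metric.ball a r)).toSignedMeasure
              - ∫ x in B ∩ Metric.ball a r, v x ∂lam)
            + (f (lam.restrict (B \ Metric.ball a r)).toSignedMeasure
              - ∫ x in B \ Metric.ball a r, v x ∂lam)| := by congr 1; ring
      _ ≤ _ := abs_add_le _ _
      _ ≤ _ := by linarith

/-- No continuity of `f` is available; finite additivity and total boundedness of Ω suffice, letting
r → 0. -/
theorem apply_toSignedMeasure_eq_integral {v : Space d → ℝ} (hv : LipschitzWith 1 v)
    (hvf : Set.EqOn v (potential f) Ω) {lam : Measure (Space d)} [IsFiniteMeasure lam]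
    (hlam : ∀ᵐ x ∂lam, x ∈ Ω) : f lam.toSignedMeasure = ∫ x, v x ∂lam := by
  have e := Measure.restrict_eq_self_of_ae_mem hlam
  have key : ∀ r > 0, |f lam.toSignedMeasure - ∫ x, v x ∂lam| ≤ 4 * r * lam.real Ω := by
    intro r hr
    obtain ⟨t, ht, hcov⟩ := Metric.totallyBounded_iff.1
      (hΩb.isCompact_closure.totallyBounded.subset subset_closure) r hr
    have h := abs_sub_setIntegral_le_of_cover hΩo hΩb hΩc hf hv hvf (lam := lam) ht.toFinset
      hΩo.measurableSet subset_rfl (by simpa using hcov)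
    rwa [Measure.toSignedMeasure_congr e, e] at h
  have h0 : |f lam.toSignedMeasure - ∫ x, v x ∂lam| ≤ 0 := by
    have hlim : Tendsto (fun r : ℝ => 4 * r * lam.real Ω) (𝓝[>] 0) (𝓝 0) := by
      have : Continuous fun r : ℝ => 4 * r * lam.real Ω := by fun_prop
      simpa using (this.tendsto 0).mono_left nhdsWithin_le_nhds
    exact ge_of_tendsto hlim (eventually_mem_nhdsWithin.mono fun r hr => key r hr)
  exact sub_eq_zero.1 (abs_nonpos_iff.1 h0)

end Potential

/-- There is no duality gap. -/
theorem exists_potential_without_gap {Ω : Set (Space d)} {g : Space d → ℝ} (hd : d ≠ 0)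
    (hΩo : IsOpen Ω) (hΩb : Bornology.IsBounded Ω)
    (hΩc : Convex ℝ Ω) (hg0 : ∀ x ∈ frontier Ω, 0 ≤ g x) (hgb : BddAbove (g '' frontier Ω))
    (hgl : LowerSemicontinuousOn g (frontier Ω)) {ρ : SignedMeasure (Space d)}
    (hρ : CarriedBy ρ Ω) :
    ∃ v, IsAdmissiblePotential Ω g v ∧ ∀ ε > 0, ∃ σ ν, IsAdmissibleCurrent Ω Ω ρ σ ν ∧
      currentCost Ω g σ ν ≤ ENNReal.ofReal (∫ᵛ x, v x ∂•ρ + ε) := by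
  obtain ⟨f, hfρ, hf⟩ := exists_linear_le_flow hd hΩo hΩb hΩc hg0 hgb hgl ρ
  obtain ⟨v, hv, hvl, hvf⟩ := exists_admissible_extension hΩo hΩb hΩc hf
  have hdec : ρ = (posPart ρ).toSignedMeasure - (negPart ρ).toSignedMeasure :=
    ρ.toSignedMeasure_toJordanDecomposition.symm
  have hres : ρ.restrict Ω = ρ := by
    conv_lhs => rw [hdec]
    rw [VectorMeasure.restrict_sub,
      restrict_toSignedMeasure_of_ae_mem hΩo.measurableSet hρ.posPart,
      restrict_toSignedMeasure_of_ae_mem hΩo.measurableSet hρ.negPart, ← hdec]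
  have heq : f ρ = ∫ᵛ x, v x ∂•ρ := by
    conv_lhs => rw [hdec]
    rw [map_sub, apply_toSignedMeasure_eq_integral hΩo hΩb hΩc hf hvl hvf hρ.posPart,
      apply_toSignedMeasure_eq_integral hΩo hΩb hΩc hf hvl hvf hρ.negPart,
      integral_signed_eq hΩb.isCompact_closure (hρ.mono subset_closure) hvl.continuous]
  refine ⟨v, hv, fun ε hε => ?_⟩
  rw [← heq]
  have h := hfρ ε hε
  rw [hres] at h
  exact h.exists_current hg0 hgb hgl

end Silo

end

/-! ### The optimality conditions -/

theorem mainTheorem5 {d : ℕ} (hd : 2 ≤ d) (Ω : Set (Silo.Space d))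
    (hΩo : IsOpen Ω) (hΩb : Bornology.IsBounded Ω) (hΩc : Convex ℝ Ω)
    (g : Silo.Space d → ℝ) (hg0 : ∀ x ∈ frontier Ω, 0 ≤ g x)
    (hgb : BddAbove (g '' frontier Ω)) (hgl : LowerSemicontinuousOn g (frontier Ω))
    (ρ : SignedMeasure (Silo.Space d)) (hρ : Silo.CarriedBy ρ Ω) :
    -- sufficiency
    (∀ (u : Silo.Space d → ℝ) (μ : Measure (Silo.Space d)) (ν : SignedMeasure (Silo.Space d))
        (w : Silo.Space d → Silo.Space d),
      Silo.IsLipOne Ω u → IsFiniteMeasure μ → μ Ωᶜ = 0 → Silo.CarriedBy ν (frontier Ω) →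
      Silo.HasTangentialGradientOn Ω μ u w →
      Silo.IsDivSolution (μ.withDensityᵥ w) ρ ν →
      (∀ᵐ x ∂μ, ‖w x‖ = 1) →
      (∀ x ∈ frontier Ω, 0 ≤ u x ∧ u x ≤ g x) →
      Silo.BoundaryComplementarity g u ν →
      Silo.IsOptimalPotential Ω g ρ u ∧
        Silo.IsOptimalCurrent Ω Ω g ρ (μ.withDensityᵥ w) ν) ∧
    -- necessity, where the tangential gradient `w` of `u` with respect to `|σ|` exists
    (∀ (u : Silo.Space d → ℝ) (σ : VectorMeasure (Silo.Space d) (Silo.Space d))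
        (ν : SignedMeasure (Silo.Space d)),
      Silo.IsOptimalPotential Ω g ρ u → Silo.IsOptimalCurrent Ω (closure Ω) g ρ σ ν →
      (∃ w, Silo.HasTangentialGradientOn Ω σ.variation u w) ∧
      (∀ w, Silo.HasTangentialGradientOn Ω σ.variation u w →
        σ = σ.variation.withDensityᵥ w ∧ ∀ᵐ x ∂σ.variation, ‖w x‖ = 1) ∧
      Silo.BoundaryComplementarity g u ν) := by
  open Silo in
  refine ⟨fun u μ ν w hu hμf hμ hν hw hdiv h1 hug hbc => ?_, fun u σ ν hu hσ => ?_⟩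
  · have hρ' := hρ.mono subset_closure
    have hw2 : MemLp w 2 μ := by
      obtain ⟨v, -, -, -, h, -⟩ := hw
      exact h
    have hwi : Integrable w μ := hw2.integrable (by norm_num)
    have hadm : IsAdmissiblePotential Ω g u := ⟨hu, hug⟩
    have hvar : (μ.withDensityᵥ w).variation = μ := by
      rw [Measure.variation_withDensityᵥ hwi]
      conv_rhs => rw [← withDensity_one (μ := μ)]
      refine withDensity_congr_ae ?_
      filter_upwards [h1] with x hx
      rw [← ofReal_norm, hx, ENNReal.ofReal_one, Pi.one_apply]
    have hcur : IsAdmissibleCurrent Ω Ω ρ (μ.withDensityᵥ w) ν :=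
      ⟨by rwa [CarriedBy, hvar], hν, hdiv⟩
    have hfin : IsFiniteMeasure (μ.withDensityᵥ w).variation := by rwa [hvar]
    have hcost : currentCost Ω g (μ.withDensityᵥ w) ν = ENNReal.ofReal (∫ᵛ x, u x ∂•ρ) := by
      rw [currentCost_eq hg0 hgb hgl hν, hvar,
        integral_potential_eq hΩb hρ' hu.continuous hν,
        integral_potential_of_hasTangentialGradientOn
          (hρ'.sub (hν.mono frontier_subset_closure)) hw hdiv h1,
        integral_eq_zero_of_ae hbc.1, integral_congr_ae hbc.2, sub_zero]
    -- Costs are compared through `ENNReal.ofReal`, which truncates negative values, so the sign is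
    -- needed to return to real inequalities.
    have hnn : 0 ≤ ∫ᵛ x, u x ∂•ρ := by
      rw [integral_potential_eq hΩb hρ' hu.continuous hν,
        integral_potential_of_hasTangentialGradientOn
          (hρ'.sub (hν.mono frontier_subset_closure)) hw hdiv h1,
        integral_eq_zero_of_ae hbc.1, integral_congr_ae hbc.2, sub_zero]
      refine add_nonneg measureReal_nonneg (integral_nonneg_of_ae ?_)
      filter_upwards [hν.posPart] with x hx using hg0 x hx
    have hmono : ∀ σ' ν', IsAdmissibleCurrent Ω Ω ρ σ' ν' →
        IsAdmissibleCurrent Ω (closure Ω) ρ σ' ν' :=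
      fun σ' ν' h => ⟨h.1.mono subset_closure, h.2⟩
    refine ⟨⟨hadm, fun v hv => ?_⟩, hcur, fun σ' ν' h => ?_⟩
    · have h2 := integral_potential_le_currentCost hΩb hg0 hgb hgl hρ' hv (hmono _ _ hcur)
      rw [hcost] at h2
      exact (ENNReal.ofReal_le_ofReal_iff hnn).1 h2
    · rw [hcost]
      exact integral_potential_le_currentCost hΩb hg0 hgb hgl hρ' hadm (hmono _ _ h)
  · have hρ' := hρ.mono subset_closure
    obtain ⟨hσa, hσm⟩ := hσ
    obtain ⟨v, hv, hgap⟩ := exists_potential_without_gap (by omega) hΩo hΩb hΩc hg0 hgb hgl hρ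
    -- The gap-free potential `v` need not be `u`, but maximality gives ∫ v dρ ≤ ∫ u dρ.
    have hle : ∀ ε > 0, currentCost Ω g σ ν ≤ ENNReal.ofReal (∫ᵛ x, u x ∂•ρ + ε) := by
      intro ε hε
      obtain ⟨σ', ν', h, hc⟩ := hgap ε hε
      exact (hσm σ' ν' h).trans (hc.trans (ENNReal.ofReal_le_ofReal (by linarith [hu.2 v hv])))
    have hfin : IsFiniteMeasure σ.variation :=
      isFiniteMeasure_variation_of_currentCost_ne_top
        (ne_top_of_le_ne_top ENNReal.ofReal_ne_top (hle 1 one_pos))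
    -- The zero potential competes, so the maximum is nonnegative and no truncation occurs.
    have hzero : IsAdmissiblePotential Ω g fun _ => 0 :=
      ⟨⟨⟨0, LipschitzWith.const 0⟩, fun x _ y _ => by simp⟩, fun x hx => ⟨le_rfl, hg0 x hx⟩⟩
    have hnn : 0 ≤ ∫ᵛ x, u x ∂•ρ := by simpa using hu.2 _ hzero
    have hcost : σ.variation.real Set.univ + ∫ x, g x ∂posPart ν ≤ ∫ᵛ x, u x ∂•ρ := by
      refine le_of_forall_pos_le_add fun ε hε => ?_
      have h := hle ε hε
      rw [currentCost_eq hg0 hgb hgl hσa.2.1] at h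
      exact (ENNReal.ofReal_le_ofReal_iff (by linarith)).1 h
    obtain ⟨heq, hbc⟩ := complementarity_of_currentCost_le hΩb hg0 hgb hgl hρ' hu.1 hσa hcost
    obtain ⟨ξ, hξi, hξ1, hσξ⟩ := exists_polar_decomposition σ
    have hdiv := hσa.2.2
    rw [hσξ] at hdiv
    have hex : HasTangentialGradientOn Ω σ.variation u ξ :=
      hasTangentialGradientOn_of_integral_eq hΩb
        (hρ'.sub (hσa.2.1.mono frontier_subset_closure)) hu.1.1 hσa.1.ae_mem
        hξi.aestronglyMeasurable hξ1 hdiv heq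
    refine ⟨⟨ξ, hex⟩, fun w hw => ?_, hbc⟩
    have hwξ := hw.ae_eq hΩb hσa.1.ae_mem hex
    refine ⟨hσξ.trans (WithDensityᵥEq.congr_ae hwξ.symm), ?_⟩
    filter_upwards [hwξ, hξ1] with x h2 h3
    rw [h2, h3]
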